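/- Let $d\ge 1$. For $q\in\mathbb R^d$ and a finite set $\mathcal X\subset\mathbb R^d$ of $m$ points, let $x^{(\pi_1)},\dots,x^{(\pi_m)}$ be its points sorted by increasing distance to $q$, and for an integer $1\le s\le m$ put $$\Phi_s(q,\mathcal X)=\frac1s\sum_{i=1}^{s}\frac{\|q-x^{(\pi_1)}\|_2}{\|q-x^{(\pi_i)}\|_2},\qquad \Phi^\circ_s(q,\mathcal X)=\frac1s\sum_{i=2}^{s}\frac{\|q-x^{(\pi_1)}\|_2}{\|q-x^{(\pi_i)}\|_2}$$ (with $0/0=0$); for real $s\ge1$ put $\Phi_s=\Phi_{\lfloor s\rfloor}$. Write $\Phi^\circ(q,\mathcal X)=\Phi^\circ_m(q,\mathcal X)$; in particular $2\,\Phi^\circ(q,\{x,y\})=\|q-x\|_2/\|q-y\|_2$ if $x\ne y$ and $\|q-x\|_2\le\|q-y\|_2$. Let $U$ be uniformly distributed on the unit sphere $\mathbb S^{d-1}$. Say that $y$ is *between $q$ and $x$ along $U$* if $\langle U,q\rangle\le\langle U,y\rangle\le\langle U,x\rangle$ or $\langle U,x\rangle\le\langle U,y\rangle\le\langle U,q\rangle$.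 **(1)** Let $q,x,y\in\mathbb R^d$ with $q\neq x$, $x\ne y$ and $\|q-x\|_2\le\|q-y\|_2$. Then $$\Pr\big[\,y\text{ is between }q\text{ and }x\text{ along }U\,\big]=\frac1\pi\arcsin\Bigg(2\,\Phi^\circ(q,\{x,y\})\sqrt{1-\Big(\frac{\langle q-x,\,y-x\rangle}{\|q-x\|_2\|y-x\|_2}\Big)^2}\Bigg).$$ **(2)** Let $\mathcal X\subset\mathbb R^d$ be a set of $m$ points and $x^\ast\in\mathcal X$ a nearest neighbor of $q$. Then $$\mathbb E_U\Big[\frac1m\,\#\{y\in\mathcal X\setminus\{x^\ast\}: y\text{ is between }q\text{ and }x^\ast\text{ along }U\}\Big]\le\frac12\,\Phi^\circ(q,\mathcal X)$$ (hence also $\le\frac12\Phi_m(q,\mathcal X)$). **(3)** Let $m_\circ\ge1$ be an integer. A Randomized Partition (RP) Tree on $\mathcal X$ is built as follows. A node with at most $m_\circ$ points is a leaf. At a node with a set $S$ of $s>m_\circ$ points, draw a uniform direction $u\in\mathbb S^{d-1}$ and a uniform $b\in[1/4,3/4]$, independently of each other and of the draws at all other nodes; let $\theta$ be the $b$-fractile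 of the projections, i.e. the $k$-th smallest of the numbers $\langle u,v\rangle$, $v\in S$, where $k=\lceil bs\rceil$, replaced by $k=s-1$ if $\lceil bs\rceil=s$ so that both children are nonempty (this happens only if $s\le3$); send the points with $\langle u,v\rangle\le\theta$ to the left child and the others to the right child. (If because of coinciding projections, an event of probability $0$, this does not separate the points of $S$, the node becomes a leaf.) Defeatist search routes $q$ by the same rule from the root to a single leaf and returns a point of that leaf closest to $q$. If $x^\ast$ is a nearest neighbor of $q$ in $\mathcal X$, where $|\mathcal X|=m$, then the probability that $x^\ast$ is not a closest point to $q$ in the leaf that is reached is at most $$\sum_{l=0}^{\ell}\Phi_{\beta^l m}\ln\frac{2e}{\Phi_{\beta^l m}},\qquad \beta=\frac34,\quad \ell=\max\Big(0,\Big\lfloor\log_{1/\beta}\frac{m}{m_\circ}\Big\rfloor\Big),\quad \Phi_s=\Phi_s(q,\mathcal X),$$ where a summand with $\Phi=0$ (this happens only if $q=x^\ast$) is read as $0$. -/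

import Mathlib

open MeasureTheory

/-! ### Nearest neighbours and the potential function -/

/-- The Euclidean space `ℝ^d`. -/
abbrev RPSpace (d : ℕ) : Type := EuclideanSpace ℝ (Fin d)

/-- `x` is a nearest neighbour of `q` in the finite collection `X`. -/
def IsNearestNeighbor {d : ℕ} (q : RPSpace d) (X : Finset (RPSpace d)) (x : RPSpace d) : Prop :=
  x ∈ X ∧ ∀ y ∈ X, ‖q - x‖ ≤ ‖q - y‖

/-- The distances from `q` to the points of `X`, listed in increasing order. -/
noncomputable def sortedDists {d : ℕ} (q : RPSpace d) (X : Finset (RPSpace d)) : List ℝ :=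
  (X.val.map fun x => ‖q - x‖).sort

/-- The ratio of the smallest distance from `q` to `X` to the `(i+1)`-st smallest one
(the index `i` starts at `0`). -/
noncomputable def distRatio {d : ℕ} (q : RPSpace d) (X : Finset (RPSpace d)) (i : ℕ) : ℝ :=
  (sortedDists q X).getD 0 0 / (sortedDists q X).getD i 0

/-- The potential `Φ_s(q, X)`: the average, over the `s` points of `X` closest to `q`, of the
ratios (distance to the nearest one) / (distance to the point). -/
noncomputable def potential {d : ℕ} (q : RPSpace d) (X : Finset (RPSpace d)) (s : ℕ) : ℝ :=
  (1 / (s : ℝ)) * ∑ i ∈ Finset.range s, distRatio q X i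

/-- The reduced potential `Φ°_s(q, X)`: the same sum without its first term (the term of the
nearest point itself), with the same normalization `1 / s`. -/
noncomputable def reducedPotential {d : ℕ} (q : RPSpace d) (X : Finset (RPSpace d)) (s : ℕ) : ℝ :=
  (1 / (s : ℝ)) * ∑ i ∈ Finset.Ico 1 s, distRatio q X i

open scoped Classical in
/-- The collection `{x, y}`. -/
noncomputable def pairCollection {d : ℕ} (x y : RPSpace d) : Finset (RPSpace d) := {x, y}

/-! ### Random directions and projections -/

/-- The uniform probability distribution on the unit sphere of `ℝ^d`: the normalized surface
measure. -/
noncomputable def sphereUniform (d : ℕ) : Measure (Metric.sphere (0 : RPSpace d) 1) :=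
  ((volume : Measure (RPSpace d)).toSphere Set.univ)⁻¹ • (volume : Measure (RPSpace d)).toSphere

instance sphereUniform_isProbabilityMeasure (d : ℕ) [NeZero d] :
    IsProbabilityMeasure (sphereUniform d) := by
  constructor
  have h0 : (volume : Measure (RPSpace d)).toSphere Set.univ ≠ 0 := by
    rw [Ne, Measure.measure_univ_eq_zero]
    exact Measure.toSphere_ne_zero _
  simp only [sphereUniform, Measure.smul_apply, smul_eq_mul]
  exact ENNReal.inv_mul_cancel h0 (measure_ne_top _ _)

/-- The projection of `y` onto `u` lies between the projections of `q` and `x`. -/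
def ProjBetween {d : ℕ} (u q x y : RPSpace d) : Prop :=
  (inner ℝ u q ≤ inner ℝ u y ∧ inner ℝ u y ≤ inner ℝ u x) ∨
    (inner ℝ u x ≤ inner ℝ u y ∧ inner ℝ u y ≤ inner ℝ u q)

open scoped Classical in
/-- The fraction of the points of `X` (other than `x` itself) whose projection onto `u` lies
between the projections of `q` and `x`. -/
noncomputable def fractionBetween {d : ℕ} (q : RPSpace d) (X : Finset (RPSpace d))
    (x u : RPSpace d) : ℝ :=
  ((X.filter fun y => y ≠ x ∧ ProjBetween u q x y).card : ℝ) / (X.card : ℝ)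

/-! ### Randomized partition trees -/

/-- A binary space partition tree: a leaf stores a set of points, an internal node stores a
direction, a threshold and the two subtrees. -/
inductive PartitionTree (d : ℕ) : Type
  | leaf (S : Finset (RPSpace d)) : PartitionTree d
  | node (u : RPSpace d) (θ : ℝ) (left right : PartitionTree d) : PartitionTree d

/-- The rank (counted from `1`) of the `b`-fractile among `s` numbers. It is `⌈b s⌉`, so that the
fractile is the smallest value with at least a fraction `b` of the numbers at or below it, but
never the top rank `s`, so that both sides of the split are nonempty
(for `1/4 ≤ b ≤ 3/4` this matters only if `s ≤ 3`). -/
noncomputable def fractileRank (b : ℝ) (s : ℕ) : ℕ := min ⌈b * s⌉₊ (s - 1)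

/-- The `b`-fractile of the projections of the points of `S` onto `u`. -/
noncomputable def fractile {d : ℕ} (u : RPSpace d) (b : ℝ) (S : Finset (RPSpace d)) : ℝ :=
  ((S.val.map fun v => inner ℝ u v).sort).getD (fractileRank b S.card - 1) 0

open scoped Classical in
/-- The points of `S` whose projection onto `u` is at most the threshold `θ`. -/
noncomputable def leftPart {d : ℕ} (u : RPSpace d) (θ : ℝ) (S : Finset (RPSpace d)) :
    Finset (RPSpace d) := S.filter fun v => inner ℝ u v ≤ θ

open scoped Classical in
/-- The points of `S` whose projection onto `u` exceeds the threshold `θ`. -/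
noncomputable def rightPart {d : ℕ} (u : RPSpace d) (θ : ℝ) (S : Finset (RPSpace d)) :
    Finset (RPSpace d) := S.filter fun v => θ < inner ℝ u v

/-- The random choices of the construction: for every possible node of the tree (addressed by the
list of turns from the root, `false` = left, `true` = right) a unit direction and a number `b`. -/
abbrev TreeSeed (d : ℕ) : Type := List Bool → Metric.sphere (0 : RPSpace d) 1 × ℝ

/-- The law of the choices at one node: a uniform direction and, independently of it, a number
uniform in `[1/4, 3/4]`. -/
noncomputable def nodeLaw (d : ℕ) : Measure (Metric.sphere (0 : RPSpace d) 1 × ℝ) :=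
  (sphereUniform d).prod (ProbabilityTheory.cond volume (Set.Icc (1 / 4 : ℝ) (3 / 4)))

instance nodeLaw_isProbabilityMeasure (d : ℕ) [NeZero d] : IsProbabilityMeasure (nodeLaw d) := by
  have : IsProbabilityMeasure
      (ProbabilityTheory.cond (volume : Measure ℝ) (Set.Icc (1 / 4 : ℝ) (3 / 4))) := by
    apply ProbabilityTheory.cond_isProbabilityMeasure_of_finite
    · rw [Real.volume_Icc]; norm_num
    · rw [Real.volume_Icc]; exact ENNReal.ofReal_ne_top
  unfold nodeLaw
  infer_instance

/-- The law of all choices: independent over the nodes. -/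
noncomputable def treeLaw (d : ℕ) [NeZero d] : Measure (TreeSeed d) :=
  Measure.infinitePi fun _ : List Bool => nodeLaw d

/-- The randomized partition tree of `S` with leaf capacity `m₀` that is produced by the choices
`ω`. A set of at most `m₀` points becomes a leaf; a larger one is split at the fractile of its
projections onto the direction drawn at its node. (If several points have the same projection, the
split may fail to separate the points; the node then becomes a leaf. This has probability zero.) -/
noncomputable def rpTree {d : ℕ} (m₀ : ℕ) (S : Finset (RPSpace d)) (ω : TreeSeed d) :
    PartitionTree d :=
  let u : RPSpace d := (ω []).1
  let θ : ℝ := fractile u (ω []).2 S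
  open scoped Classical in
  if _h : m₀ < S.card ∧ (leftPart u θ S).card < S.card ∧ (rightPart u θ S).card < S.card then
    PartitionTree.node u θ
      (rpTree m₀ (leftPart u θ S) fun a => ω (false :: a))
      (rpTree m₀ (rightPart u θ S) fun a => ω (true :: a))
  else PartitionTree.leaf S
termination_by S.card
decreasing_by
  · exact _h.2.1
  · exact _h.2.2

open scoped Classical in
/-- The points in the cell of the query `q`: a single root-to-leaf traversal, without
backtracking. -/
noncomputable def defeatistLeaf {d : ℕ} (q : RPSpace d) : PartitionTree d → Finset (RPSpace d)
  | PartitionTree.leaf S => S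
  | PartitionTree.node u θ l r => if inner ℝ u q ≤ θ then defeatistLeaf q l else defeatistLeaf q r

/-- Defeatist search for `q` in the tree `t` finds `x`: the point `x` is a closest point to `q`
among the points in the leaf that `q` reaches. -/
def DefeatistFinds {d : ℕ} (q : RPSpace d) (t : PartitionTree d) (x : RPSpace d) : Prop :=
  IsNearestNeighbor q (defeatistLeaf q t) x

/-! ### The uniform distribution on the sphere and cones -/

open scoped Pointwise in
theorem sphereUniform_real_cone {d : ℕ} [NeZero d] {C : Set (RPSpace d)} (hm : MeasurableSet C)
    (hC : ∀ r : ℝ, 0 < r → ∀ z : RPSpace d, r • z ∈ C ↔ z ∈ C) :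
    (sphereUniform d).real {u : Metric.sphere (0 : RPSpace d) 1 | (u : RPSpace d) ∈ C} =
      (volume : Measure (RPSpace d)).real (C ∩ Metric.ball 0 1) /
        (volume : Measure (RPSpace d)).real (Metric.ball 0 1) := by
  have hset : Set.Ioo (0 : ℝ) 1 • (Subtype.val '' {u : Metric.sphere (0 : RPSpace d) 1 |
      (u : RPSpace d) ∈ C}) = (C ∩ Metric.ball 0 1) \ {0} := by
    ext z
    simp only [Set.mem_smul, Set.mem_image, Set.mem_ofPred_eq, Set.mem_sdiff, Set.mem_inter_iff,
      Metric.mem_ball, dist_zero_right, Set.mem_singleton_iff]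
    constructor
    · rintro ⟨r, ⟨hr0, hr1⟩, _, ⟨u, hu, rfl⟩, rfl⟩
      have hn : ‖(u : RPSpace d)‖ = 1 := norm_eq_of_mem_sphere u
      refine ⟨⟨(hC r hr0 _).2 hu, ?_⟩, ?_⟩
      · rw [norm_smul, hn, Real.norm_of_nonneg hr0.le]; linarith
      · intro h0
        have := congrArg norm h0
        rw [norm_smul, hn, Real.norm_of_nonneg hr0.le, norm_zero] at this
        linarith
    · rintro ⟨⟨hz, hz1⟩, hz0⟩
      have hp : 0 < ‖z‖ := norm_pos_iff.2 hz0
      refine ⟨‖z‖, ⟨hp, hz1⟩, ‖z‖⁻¹ • z, ⟨⟨‖z‖⁻¹ • z, ?_⟩, ?_, rfl⟩, ?_⟩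
      · simp [norm_smul, hp.ne']
      · exact (hC _ (inv_pos.2 hp) _).2 hz
      · rw [smul_smul, mul_inv_cancel₀ hp.ne', one_smul]
  have hms : MeasurableSet {u : Metric.sphere (0 : RPSpace d) 1 | (u : RPSpace d) ∈ C} :=
    measurable_subtype_coe hm
  have hd : (Module.finrank ℝ (RPSpace d) : ℝ) ≠ 0 := by
    simp [NeZero.ne d]
  have hcone : (volume : Measure (RPSpace d)).toSphere.real
      {u : Metric.sphere (0 : RPSpace d) 1 | (u : RPSpace d) ∈ C} =
      Module.finrank ℝ (RPSpace d) * (volume : Measure (RPSpace d)).real (C ∩ Metric.ball 0 1) := by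
    rw [measureReal_def, Measure.toSphere_apply' _ hms, hset,
      measure_sdiff_null (measure_singleton _), ENNReal.toReal_mul, measureReal_def,
      ENNReal.toReal_natCast]
  rw [sphereUniform, measureReal_ennreal_smul_apply, ENNReal.toReal_inv, ← measureReal_def, hcone,
    Measure.toSphere_real_apply_univ, ← div_eq_inv_mul, mul_div_mul_left _ _ hd]

theorem sphereUniform_real_comp_isometry {d : ℕ} [NeZero d] {C : Set (RPSpace d)}
    (hm : MeasurableSet C) (hC : ∀ r : ℝ, 0 < r → ∀ z : RPSpace d, r • z ∈ C ↔ z ∈ C)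
    (f : RPSpace d ≃ₗᵢ[ℝ] RPSpace d) :
    (sphereUniform d).real {u : Metric.sphere (0 : RPSpace d) 1 | f (u : RPSpace d) ∈ C} =
      (sphereUniform d).real {u : Metric.sphere (0 : RPSpace d) 1 | (u : RPSpace d) ∈ C} := by
  have hfm : Measurable f := f.continuous.measurable
  have h := sphereUniform_real_cone (C := f ⁻¹' C) (hfm hm)
    (fun r hr z => by simp only [Set.mem_preimage, map_smul]; exact hC r hr _)
  simp only [Set.mem_preimage] at h
  rw [h, sphereUniform_real_cone hm hC]
  congr 1
  have hb : f ⁻¹' C ∩ Metric.ball 0 1 = f ⁻¹' (C ∩ Metric.ball 0 1) := by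
    ext z; simp
  rw [hb, measureReal_def, measureReal_def,
    f.measurePreserving.measure_preimage (hm.inter measurableSet_ball).nullMeasurableSet]

theorem sphereUniform_ae_inner_ne_zero {d : ℕ} [NeZero d] {v : RPSpace d} (hv : v ≠ 0) :
    ∀ᵐ u : Metric.sphere (0 : RPSpace d) 1 ∂(sphereUniform d), inner ℝ (u : RPSpace d) v ≠ 0 := by
  rw [ae_iff]
  simp only [ne_eq, not_not]
  have hm : MeasurableSet {z : RPSpace d | inner ℝ z v = 0} :=
    measurableSet_eq_fun (by fun_prop) measurable_const
  have h := sphereUniform_real_cone hm (fun r hr z => by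
    simp [inner_smul_left, hr.ne'])
  have h0 : (volume : Measure (RPSpace d)) {z : RPSpace d | inner ℝ z v = 0} = 0 := by
    have hE : {z : RPSpace d | inner ℝ z v = 0} = ((ℝ ∙ v)ᗮ : Submodule ℝ (RPSpace d)) := by
      ext z
      simp [Submodule.mem_orthogonal_singleton_iff_inner_left]
    rw [hE]
    apply Measure.addHaar_submodule
    intro htop
    have : v ∈ (ℝ ∙ v)ᗮ := htop ▸ Submodule.mem_top
    rw [Submodule.mem_orthogonal_singleton_iff_inner_left, inner_self_eq_zero] at this
    exact hv this
  have h1 : (volume : Measure (RPSpace d)).real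
      ({z : RPSpace d | inner ℝ z v = 0} ∩ Metric.ball 0 1) = 0 := by
    rw [measureReal_def, measure_mono_null Set.inter_subset_left h0, ENNReal.toReal_zero]
  rw [h1, zero_div, measureReal_eq_zero_iff] at h
  exact h

/-! ### The probability that a random hyperplane separates two vectors -/

/-- The probability that a uniform direction has scalar products of opposite signs with `v` and
`w`. -/
noncomputable def signChangeProb {d : ℕ} (v w : RPSpace d) : ℝ :=
  (sphereUniform d).real {u : Metric.sphere (0 : RPSpace d) 1 |
    inner ℝ (u : RPSpace d) v * inner ℝ (u : RPSpace d) w < 0}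

theorem measurableSet_signChange {d : ℕ} (v w : RPSpace d) :
    MeasurableSet {z : RPSpace d | inner ℝ z v * inner ℝ z w < 0} :=
  measurableSet_lt (by fun_prop) measurable_const

theorem signChangeProb_smul {d : ℕ} {a b : ℝ} (hab : 0 < a * b) (v w : RPSpace d) :
    signChangeProb (a • v) (b • w) = signChangeProb v w := by
  unfold signChangeProb
  congr 1
  ext u
  simp only [inner_smul_right, Set.mem_ofPred_eq]
  rw [show a * inner ℝ (u : RPSpace d) v * (b * inner ℝ (u : RPSpace d) w) =
    a * b * (inner ℝ (u : RPSpace d) v * inner ℝ (u : RPSpace d) w) by ring]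
  constructor
  · intro h; by_contra! h'; nlinarith [mul_nonneg hab.le h']
  · intro h; exact mul_neg_of_pos_of_neg hab h

theorem signChangeProb_neg_neg {d : ℕ} (v w : RPSpace d) :
    signChangeProb (-v) (-w) = signChangeProb v w := by
  simp only [signChangeProb, inner_neg_right, neg_mul_neg]

theorem signChangeProb_isometry {d : ℕ} [NeZero d] (f : RPSpace d ≃ₗᵢ[ℝ] RPSpace d)
    (v w : RPSpace d) : signChangeProb (f v) (f w) = signChangeProb v w := by
  have h := sphereUniform_real_comp_isometry (measurableSet_signChange (f v) (f w))
    (fun r hr z => by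
      simp only [Set.mem_ofPred_eq, inner_smul_left, RCLike.conj_to_real]
      rw [show r * inner ℝ z (f v) * (r * inner ℝ z (f w)) =
        r ^ 2 * (inner ℝ z (f v) * inner ℝ z (f w)) by ring]
      have hr2 : 0 < r ^ 2 := by positivity
      constructor
      · intro h; by_contra! h'; nlinarith [mul_nonneg hr2.le h']
      · intro h; exact mul_neg_of_pos_of_neg hr2 h) f
  simp only [Set.mem_ofPred_eq, f.inner_map_map] at h
  exact h.symm

theorem signChangeProb_self {d : ℕ} (v : RPSpace d) : signChangeProb v v = 0 := by
  unfold signChangeProb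
  convert measureReal_empty (μ := sphereUniform d)
  ext u
  simp [mul_self_nonneg]

theorem signChangeProb_neg_self {d : ℕ} [NeZero d] {v : RPSpace d} (hv : v ≠ 0) :
    signChangeProb v (-v) = 1 := by
  have h : {u : Metric.sphere (0 : RPSpace d) 1 |
      inner ℝ (u : RPSpace d) v * inner ℝ (u : RPSpace d) (-v) < 0} =ᵐ[sphereUniform d]
        Set.univ := by
    rw [Filter.eventuallyEq_set]
    filter_upwards [sphereUniform_ae_inner_ne_zero hv] with u hu
    simp [inner_neg_right, mul_neg, mul_self_pos.2 hu]
  rw [signChangeProb, measureReal_congr h, probReal_univ]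

theorem signChangeProb_add {d : ℕ} [NeZero d] {v w z : RPSpace d} (hv : v ≠ 0) (hw : w ≠ 0)
    (hz : z ≠ 0) (h : (∃ a b : ℝ, 0 ≤ a ∧ 0 ≤ b ∧ w = a • v + b • z) ∨ z = -v) :
    signChangeProb v z = signChangeProb v w + signChangeProb w z := by
  have hdisj : Disjoint
      {u : Metric.sphere (0 : RPSpace d) 1 |
        inner ℝ (u : RPSpace d) v * inner ℝ (u : RPSpace d) w < 0}
      {u : Metric.sphere (0 : RPSpace d) 1 |
        inner ℝ (u : RPSpace d) w * inner ℝ (u : RPSpace d) z < 0} := by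
    rw [Set.disjoint_left]
    intro u h1 h2
    simp only [Set.mem_ofPred_eq, mul_neg_iff] at h1 h2
    rcases h with ⟨a, b, ha, hb, rfl⟩ | rfl
    · simp only [inner_add_right, inner_smul_right] at h1 h2
      rcases h1 with h1 | h1 <;> rcases h2 with h2 | h2
      · linarith
      · nlinarith [mul_nonneg ha h1.1.le, mul_nonneg hb h2.2.le]
      · nlinarith [mul_nonneg ha (neg_nonneg.2 h1.1.le), mul_nonneg hb (neg_nonneg.2 h2.2.le)]
      · linarith
    · simp only [inner_neg_right] at h1 h2
      rcases h1 with h1 | h1 <;> rcases h2 with h2 | h2 <;> linarith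
  have hm : MeasurableSet {u : Metric.sphere (0 : RPSpace d) 1 |
        inner ℝ (u : RPSpace d) w * inner ℝ (u : RPSpace d) z < 0} :=
    measurable_subtype_coe (measurableSet_signChange w z)
  unfold signChangeProb
  rw [← measureReal_union hdisj hm]
  apply measureReal_congr
  rw [Filter.eventuallyEq_set]
  filter_upwards [sphereUniform_ae_inner_ne_zero hv, sphereUniform_ae_inner_ne_zero hw,
    sphereUniform_ae_inner_ne_zero hz] with u h1 h2 h3
  simp only [Set.mem_union, Set.mem_ofPred_eq, mul_neg_iff]
  rcases h with ⟨a, b, ha, hb, rfl⟩ | rfl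
  · rcases lt_or_gt_of_ne h1 with h1 | h1 <;> rcases lt_or_gt_of_ne h2 with h2 | h2 <;>
      rcases lt_or_gt_of_ne h3 with h3 | h3 <;> simp [h1, h2, h3, h1.not_gt, h2.not_gt, h3.not_gt]
    · simp only [inner_add_right, inner_smul_right] at h2
      nlinarith [mul_nonneg ha (neg_nonneg.2 h1.le), mul_nonneg hb (neg_nonneg.2 h3.le)]
    · simp only [inner_add_right, inner_smul_right] at h2
      nlinarith [mul_nonneg ha h1.le, mul_nonneg hb h3.le]
  · simp only [inner_neg_right] at h3 ⊢
    rcases lt_or_gt_of_ne h1 with h1 | h1 <;> rcases lt_or_gt_of_ne h2 with h2 | h2 <;>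
      simp [h1, h2, h1.not_gt, h2.not_gt]

/-- A bounded additive function on `[0, T]` that vanishes at `T` is zero. -/
theorem eq_zero_of_additive_of_bounded {T : ℝ} {h : ℝ → ℝ}
    (hadd : ∀ s t, 0 ≤ s → 0 ≤ t → s + t ≤ T → h (s + t) = h s + h t)
    (hb : ∀ t, 0 ≤ t → t ≤ T → |h t| ≤ 1) (hT : h T = 0) {t : ℝ} (h0 : 0 ≤ t) (h1 : t ≤ T) :
    h t = 0 := by
  have key : ∀ n : ℕ, ∀ t, 0 ≤ t → t ≤ T → |h t| ≤ (1 / 2) ^ n := by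
    intro n
    induction n with
    | zero => simpa using hb
    | succ n ih =>
      have half : ∀ t, 0 ≤ t → t + t ≤ T → |h t| ≤ (1 / 2) ^ (n + 1) := by
        intro t h0 h1
        have := ih (t + t) (by linarith) h1
        rw [hadd t t h0 h0 h1, ← two_mul, abs_mul, abs_two] at this
        rw [pow_succ]; linarith
      intro t h0 h1
      rcases le_total (t + t) T with h2 | h2
      · exact half t h0 h2
      · have h3 := hadd t (T - t) h0 (by linarith) (by linarith)
        rw [add_sub_cancel, hT] at h3
        rw [show h t = -h (T - t) by linarith, abs_neg]
        exact half _ (by linarith) (by linarith)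
  have h2 : |h t| ≤ 0 := ge_of_tendsto'
    (tendsto_pow_atTop_nhds_zero_of_lt_one (by norm_num : (0 : ℝ) ≤ 1 / 2) (by norm_num))
    fun n => key n t h0 h1
  exact abs_nonpos_iff.1 h2

/-- The unit vector at angle `t` in the plane with orthonormal basis `e₁, e₂`. -/
noncomputable def planeVector {d : ℕ} (e₁ e₂ : RPSpace d) (t : ℝ) : RPSpace d :=
  Real.cos t • e₁ + Real.sin t • e₂

section Plane

variable {d : ℕ} {e₁ e₂ : RPSpace d}

theorem inner_planeVector (h₁ : ‖e₁‖ = 1) (h₂ : ‖e₂‖ = 1) (h : inner ℝ e₁ e₂ = 0) (s t : ℝ) :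
    inner ℝ (planeVector e₁ e₂ s) (planeVector e₁ e₂ t) = Real.cos (s - t) := by
  have h' : inner ℝ e₂ e₁ = 0 := by rw [real_inner_comm, h]
  simp only [planeVector, inner_add_left, inner_add_right, inner_smul_left, inner_smul_right,
    real_inner_self_eq_norm_sq, h₁, h₂, h, h', Real.cos_sub, RCLike.conj_to_real]
  ring

theorem norm_planeVector (h₁ : ‖e₁‖ = 1) (h₂ : ‖e₂‖ = 1) (h : inner ℝ e₁ e₂ = 0) (t : ℝ) :
    ‖planeVector e₁ e₂ t‖ = 1 := by
  have := inner_planeVector h₁ h₂ h t t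
  rw [real_inner_self_eq_norm_sq, sub_self, Real.cos_zero] at this
  exact (pow_eq_one_iff_of_nonneg (norm_nonneg _) two_ne_zero).1 this

theorem reflection_planeVector (h₁ : ‖e₁‖ = 1) (h₂ : ‖e₂‖ = 1) (h : inner ℝ e₁ e₂ = 0)
    (a t : ℝ) :
    (ℝ ∙ planeVector e₁ e₂ a)ᗮ.reflection (planeVector e₁ e₂ t) =
      -planeVector e₁ e₂ (2 * a - t) := by
  rw [Submodule.reflection_orthogonal_apply, Submodule.reflection_singleton_apply]
  simp only [inner_planeVector h₁ h₂ h, norm_planeVector h₁ h₂ h]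
  rw [neg_inj]
  simp only [planeVector]
  have hc : Real.cos (2 * a - t) = 2 * Real.cos (a - t) * Real.cos a - Real.cos t := by
    rw [show 2 * a - t = (a - t) + a by ring, Real.cos_add]
    nth_rewrite 4 [show t = a - (a - t) by ring]
    rw [Real.cos_sub a (a - t)]; ring
  have hs : Real.sin (2 * a - t) = 2 * Real.cos (a - t) * Real.sin a - Real.sin t := by
    rw [show 2 * a - t = (a - t) + a by ring, Real.sin_add]
    nth_rewrite 4 [show t = a - (a - t) by ring]
    rw [Real.sin_sub a (a - t)]; ring
  rw [hc, hs]
  norm_num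
  module

theorem signChangeProb_planeVector_shift [NeZero d] (h₁ : ‖e₁‖ = 1) (h₂ : ‖e₂‖ = 1)
    (h : inner ℝ e₁ e₂ = 0) (s t : ℝ) :
    signChangeProb (planeVector e₁ e₂ s) (planeVector e₁ e₂ (s + t)) =
      signChangeProb (planeVector e₁ e₂ 0) (planeVector e₁ e₂ t) := by
  have ha := signChangeProb_isometry (ℝ ∙ planeVector e₁ e₂ (s / 2))ᗮ.reflection
    (planeVector e₁ e₂ s) (planeVector e₁ e₂ (s + t))
  have hb := signChangeProb_isometry (ℝ ∙ planeVector e₁ e₂ 0)ᗮ.reflection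
    (planeVector e₁ e₂ 0) (planeVector e₁ e₂ t)
  rw [reflection_planeVector h₁ h₂ h, reflection_planeVector h₁ h₂ h, signChangeProb_neg_neg]
    at ha hb
  rw [show 2 * (s / 2) - s = 0 by ring, show 2 * (s / 2) - (s + t) = -t by ring] at ha
  rw [show 2 * (0 : ℝ) - 0 = 0 by ring, show 2 * (0 : ℝ) - t = -t by ring] at hb
  exact ha.symm.trans hb

theorem signChangeProb_planeVector [NeZero d] (h₁ : ‖e₁‖ = 1) (h₂ : ‖e₂‖ = 1)
    (h : inner ℝ e₁ e₂ = 0) {t : ℝ} (ht0 : 0 ≤ t) (ht : t ≤ Real.pi) :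
    signChangeProb (planeVector e₁ e₂ 0) (planeVector e₁ e₂ t) = t / Real.pi := by
  have hpi := Real.pi_pos
  have hne : ∀ t, planeVector e₁ e₂ t ≠ 0 := fun t h0 => by
    have := norm_planeVector h₁ h₂ h t
    rw [h0, norm_zero] at this
    exact zero_ne_one this
  have hneg : planeVector e₁ e₂ Real.pi = -planeVector e₁ e₂ 0 := by simp [planeVector]
  have hone : signChangeProb (planeVector e₁ e₂ 0) (planeVector e₁ e₂ Real.pi) = 1 := by
    rw [hneg]; exact signChangeProb_neg_self (hne 0)
  have key := eq_zero_of_additive_of_bounded (T := Real.pi)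
    (h := fun t => signChangeProb (planeVector e₁ e₂ 0) (planeVector e₁ e₂ t) - t / Real.pi)
    ?_ ?_ ?_ ht0 ht
  · exact sub_eq_zero.1 key
  · intro s t hs ht hst
    have := signChangeProb_add (hne 0) (hne s) (hne (s + t)) ?_
    · rw [signChangeProb_planeVector_shift h₁ h₂ h] at this
      simp only [this]; ring
    · rcases hst.eq_or_lt with hst | hst
      · right; rw [hst, hneg]
      · rcases (add_nonneg hs ht).eq_or_lt with h0 | h0
        · have hs0 : s = 0 := by linarith
          exact Or.inl ⟨1, 0, zero_le_one, le_rfl, by simp [hs0]⟩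
        · have hsin := Real.sin_pos_of_pos_of_lt_pi h0 hst
          refine Or.inl ⟨Real.sin t / Real.sin (s + t), Real.sin s / Real.sin (s + t),
            div_nonneg (Real.sin_nonneg_of_nonneg_of_le_pi ht (by linarith)) hsin.le,
            div_nonneg (Real.sin_nonneg_of_nonneg_of_le_pi hs (by linarith)) hsin.le, ?_⟩
          simp only [planeVector, Real.cos_zero, Real.sin_zero, one_smul, zero_smul, add_zero,
            smul_add, smul_smul]
          rw [← add_assoc, ← add_smul]
          congr 2
          · field_simp
            rw [Real.sin_add, Real.cos_add]
            linear_combination (Real.sin t) * Real.sin_sq_add_cos_sq s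
          · field_simp
  · intro t h0 h1
    have ha : 0 ≤ signChangeProb (planeVector e₁ e₂ 0) (planeVector e₁ e₂ t) :=
      measureReal_nonneg
    have hb : signChangeProb (planeVector e₁ e₂ 0) (planeVector e₁ e₂ t) ≤ 1 :=
      measureReal_le_one
    have hc : 0 ≤ t / Real.pi := by positivity
    have hd : t / Real.pi ≤ 1 := (div_le_one hpi).2 h1
    rw [abs_le]; constructor <;> linarith
  · simp only [hone, div_self hpi.ne', sub_self]

end Plane

theorem signChangeProb_eq_angle_div_pi {d : ℕ} [NeZero d] {v w : RPSpace d} (hv : v ≠ 0)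
    (hw : w ≠ 0) : signChangeProb v w = InnerProductGeometry.angle v w / Real.pi := by
  have hv' := norm_pos_iff.2 hv
  have hw' := norm_pos_iff.2 hw
  set α := InnerProductGeometry.angle v w with hα
  have hcos : inner ℝ v w = Real.cos α * (‖v‖ * ‖w‖) :=
    (InnerProductGeometry.cos_angle_mul_norm_mul_norm v w).symm
  have hα0 : 0 ≤ α := InnerProductGeometry.angle_nonneg v w
  have hα1 : α ≤ Real.pi := InnerProductGeometry.angle_le_pi v w
  rcases hα0.eq_or_lt with h0 | h0
  · obtain ⟨-, r, hr, rfl⟩ := InnerProductGeometry.angle_eq_zero_iff.1 (hα.symm.trans h0.symm)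
    rw [← h0, zero_div]
    nth_rewrite 1 [← one_smul ℝ v]
    rw [signChangeProb_smul (by linarith), signChangeProb_self]
  rcases hα1.eq_or_lt with h1 | h1
  · obtain ⟨-, r, hr, rfl⟩ := InnerProductGeometry.angle_eq_pi_iff.1 (hα.symm.trans h1)
    rw [h1, div_self Real.pi_pos.ne']
    nth_rewrite 1 [← one_smul ℝ v]
    rw [show r • v = (-r) • (-v) by simp, signChangeProb_smul (by linarith),
      signChangeProb_neg_self hv]
  have hsin := Real.sin_pos_of_pos_of_lt_pi h0 h1
  set e₁ : RPSpace d := ‖v‖⁻¹ • v with he₁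
  set e₂ : RPSpace d := (Real.sin α)⁻¹ • (‖w‖⁻¹ • w - Real.cos α • e₁) with he₂
  have hw1 : ‖w‖⁻¹ • w = planeVector e₁ e₂ α := by
    rw [planeVector, he₂, smul_inv_smul₀ hsin.ne', add_sub_cancel]
  have hv1 : ‖v‖⁻¹ • v = planeVector e₁ e₂ 0 := by simp [planeVector, he₁]
  have hvw : signChangeProb v w = signChangeProb (‖v‖⁻¹ • v) (‖w‖⁻¹ • w) :=
    (signChangeProb_smul (by positivity) v w).symm
  have n₁ : ‖e₁‖ = 1 := by simp [he₁, norm_smul, hv'.ne']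
  have i₁ : inner ℝ e₁ (‖w‖⁻¹ • w) = Real.cos α := by
    rw [he₁, inner_smul_left, inner_smul_right, hcos]
    simp only [RCLike.conj_to_real]
    field_simp
  have i₂ : inner ℝ e₁ e₂ = 0 := by
    rw [he₂, inner_smul_right, inner_sub_right, i₁, inner_smul_right, real_inner_self_eq_norm_sq,
      n₁]
    simp
  have n₂ : ‖e₂‖ = 1 := by
    have hw2 : ‖‖w‖⁻¹ • w‖ = 1 := by simp [norm_smul, hw'.ne']
    have hsq : ‖‖w‖⁻¹ • w - Real.cos α • e₁‖ ^ 2 = Real.sin α ^ 2 := by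
      rw [norm_sub_sq_real, hw2, inner_smul_right, real_inner_comm, i₁, norm_smul, n₁,
        Real.norm_eq_abs, mul_one, sq_abs, Real.sin_sq]
      ring
    have := (pow_left_inj₀ (norm_nonneg _) hsin.le two_ne_zero).1 hsq
    rw [he₂, norm_smul, this, norm_inv, Real.norm_of_nonneg hsin.le, inv_mul_cancel₀ hsin.ne']
  rw [hvw, hv1, hw1, signChangeProb_planeVector n₁ n₂ i₂ hα0 hα1]

/-! ### Order statistics -/

theorem List.getD_iff_lt_countP {l : List ℝ} (hl : l.Pairwise (· ≤ ·)) {p : ℝ → Prop}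
    [DecidablePred p] (hp : ∀ a b, a ≤ b → p b → p a) {i : ℕ} (hi : i < l.length) :
    p (l.getD i 0) ↔ i < l.countP p := by
  induction l generalizing i with
  | nil => simp at hi
  | cons a l ih =>
    rw [List.pairwise_cons] at hl
    rw [List.countP_cons]
    by_cases ha : p a
    · rcases i with _ | i
      · simp [ha]
      · rw [List.getD_cons_succ, ih hl.2 (by simpa using hi)]
        simp [ha]
    · have h0 : l.countP p = 0 := by
        rw [List.countP_eq_zero]
        intro b hb
        simpa using fun h => ha (hp a b (hl.1 b hb) h)
      rw [h0]
      simp only [ha, decide_false, Bool.false_eq_true, if_false, Nat.not_lt_zero, iff_false,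
        add_zero]
      rcases i with _ | i
      · simpa using ha
      · have hi' : i < l.length := by simpa using hi
        rw [List.getD_cons_succ, List.getD_eq_getElem _ _ hi']
        exact fun h => ha (hp a _ (hl.1 _ (List.getElem_mem hi')) h)

theorem Multiset.sort_getD_iff {M : Multiset ℝ} {p : ℝ → Prop} [DecidablePred p]
    (hp : ∀ a b, a ≤ b → p b → p a) {i : ℕ} (hi : i < M.card) :
    p (M.sort.getD i 0) ↔ i < M.countP p := by
  rw [List.getD_iff_lt_countP (Multiset.pairwise_sort M _) hp (by simpa using hi)]
  conv_rhs => rw [← Multiset.sort_eq M (· ≤ ·), Multiset.coe_countP]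

theorem List.sum_range_getD (l : List ℝ) (f : ℝ → ℝ) :
    ∑ i ∈ Finset.range l.length, f (l.getD i 0) = (l.map f).sum := by
  induction l with
  | nil => simp
  | cons a l ih =>
    rw [List.length_cons, Finset.sum_range_succ', List.map_cons, List.sum_cons, ← ih, add_comm]
    simp

section Potential

variable {d : ℕ} {q x : RPSpace d} {X S : Finset (RPSpace d)}

theorem card_pos_of_isNearestNeighbor (hx : IsNearestNeighbor q X x) : 0 < X.card :=
  Finset.card_pos.2 ⟨x, hx.1⟩

theorem sortedDists_getD_lt_iff {i : ℕ} (hi : i < X.card) (t : ℝ) :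
    (sortedDists q X).getD i 0 < t ↔ i < (X.filter fun y => ‖q - y‖ < t).card := by
  rw [sortedDists, Multiset.sort_getD_iff (p := fun a => a < t) (fun a b h => h.trans_lt)
    (by simpa using hi), Multiset.countP_map]
  rfl

theorem sortedDists_getD_zero (hx : IsNearestNeighbor q X x) :
    (sortedDists q X).getD 0 0 = ‖q - x‖ := by
  have hpos := card_pos_of_isNearestNeighbor hx
  apply le_antisymm
  · by_contra! h
    have h2 := (sortedDists_getD_lt_iff (q := q) hpos ((sortedDists q X).getD 0 0)).not.1
      (lt_irrefl _)
    rw [Nat.pos_iff_ne_zero, not_not, Finset.card_eq_zero, Finset.filter_eq_empty_iff] at h2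
    exact h2 hx.1 h
  · rw [← not_lt, sortedDists_getD_lt_iff hpos, Nat.pos_iff_ne_zero, not_not, Finset.card_eq_zero,
      Finset.filter_eq_empty_iff]
    exact fun y hy => (hx.2 y hy).not_gt

theorem le_sortedDists_getD (hx : IsNearestNeighbor q X x) {i : ℕ} (hi : i < X.card) :
    ‖q - x‖ ≤ (sortedDists q X).getD i 0 := by
  rw [← not_lt, sortedDists_getD_lt_iff hi]
  have : (X.filter fun y => ‖q - y‖ < ‖q - x‖) = ∅ :=
    Finset.filter_eq_empty_iff.2 fun y hy => (hx.2 y hy).not_gt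
  simp [this]

theorem sortedDists_getD_le_of_subset (hSX : S ⊆ X) {i : ℕ} (hi : i < S.card) :
    (sortedDists q X).getD i 0 ≤ (sortedDists q S).getD i 0 := by
  have hi' : i < X.card := hi.trans_le (Finset.card_le_card hSX)
  rw [← not_lt, sortedDists_getD_lt_iff hi]
  have h := (sortedDists_getD_lt_iff (q := q) hi' ((sortedDists q X).getD i 0)).not.1
    (lt_irrefl _)
  exact fun h' => h (h'.trans_le (Finset.card_le_card (Finset.filter_subset_filter _ hSX)))

theorem sortedDists_getD_nonneg (q : RPSpace d) (X : Finset (RPSpace d)) (i : ℕ) :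
    0 ≤ (sortedDists q X).getD i 0 := by
  rcases lt_or_ge i X.card with hi | hi
  · rw [← not_lt, sortedDists_getD_lt_iff hi]
    have : (X.filter fun y => ‖q - y‖ < 0) = ∅ :=
      Finset.filter_eq_empty_iff.2 fun y hy => (norm_nonneg _).not_gt
    simp [this]
  · rw [List.getD_eq_default _ _ (by simpa [sortedDists] using hi)]

theorem distRatio_nonneg (q : RPSpace d) (X : Finset (RPSpace d)) (i : ℕ) :
    0 ≤ distRatio q X i :=
  div_nonneg (sortedDists_getD_nonneg q X 0) (sortedDists_getD_nonneg q X i)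

theorem distRatio_le_one (hx : IsNearestNeighbor q X x) (i : ℕ) : distRatio q X i ≤ 1 := by
  rcases lt_or_ge i X.card with hi | hi
  · apply div_le_one_of_le₀ _ (sortedDists_getD_nonneg q X i)
    rw [sortedDists_getD_zero hx]
    exact le_sortedDists_getD hx hi
  · rw [distRatio, List.getD_eq_default (n := i) _ _ (by simpa [sortedDists] using hi), div_zero]
    exact zero_le_one

theorem distRatio_zero (hx : IsNearestNeighbor q X x) (hqx : q ≠ x) : distRatio q X 0 = 1 := by
  rw [distRatio, sortedDists_getD_zero hx, div_self (norm_ne_zero_iff.2 (sub_ne_zero.2 hqx))]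

theorem IsNearestNeighbor.mono (hx : IsNearestNeighbor q X x) (hSX : S ⊆ X) (hxS : x ∈ S) :
    IsNearestNeighbor q S x :=
  ⟨hxS, fun y hy => hx.2 y (hSX hy)⟩

theorem distRatio_le_of_subset (hx : IsNearestNeighbor q X x) (hSX : S ⊆ X) (hxS : x ∈ S) {i : ℕ}
    (hi : i < S.card) : distRatio q S i ≤ distRatio q X i := by
  have hi' : i < X.card := hi.trans_le (Finset.card_le_card hSX)
  rw [distRatio, distRatio, sortedDists_getD_zero hx, sortedDists_getD_zero (hx.mono hSX hxS)]
  rcases eq_or_ne q x with rfl | hqx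
  · simp
  · exact div_le_div_of_nonneg_left (norm_nonneg _)
      ((norm_pos_iff.2 (sub_ne_zero.2 hqx)).trans_le (le_sortedDists_getD hx hi'))
      (sortedDists_getD_le_of_subset hSX hi)

theorem potential_nonneg (q : RPSpace d) (X : Finset (RPSpace d)) (s : ℕ) : 0 ≤ potential q X s :=
  mul_nonneg (by positivity) (Finset.sum_nonneg fun i _ => distRatio_nonneg q X i)

theorem natCast_mul_potential (q : RPSpace d) (X : Finset (RPSpace d)) (s : ℕ) :
    s * potential q X s = ∑ i ∈ Finset.range s, distRatio q X i := by
  rcases Nat.eq_zero_or_pos s with rfl | hs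
  · simp
  · rw [potential]; field_simp

theorem potential_le_one (hx : IsNearestNeighbor q X x) (s : ℕ) : potential q X s ≤ 1 := by
  rcases Nat.eq_zero_or_pos s with rfl | hs
  · simp [potential]
  have hs' : (0 : ℝ) < s := by exact_mod_cast hs
  have h := Finset.sum_le_sum fun i (_ : i ∈ Finset.range s) => distRatio_le_one hx i
  rw [← natCast_mul_potential, Finset.sum_const, Finset.card_range, nsmul_eq_mul] at h
  exact le_of_mul_le_mul_left h hs'

theorem natCast_mul_potential_mono (q : RPSpace d) (X : Finset (RPSpace d)) {s n : ℕ}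
    (hsn : s ≤ n) : s * potential q X s ≤ n * potential q X n := by
  rw [natCast_mul_potential, natCast_mul_potential]
  exact Finset.sum_le_sum_of_subset_of_nonneg (Finset.range_mono hsn)
    fun i _ _ => distRatio_nonneg q X i

theorem one_div_le_potential (hx : IsNearestNeighbor q X x) (hqx : q ≠ x) {s : ℕ} (hs : 0 < s) :
    1 / (s : ℝ) ≤ potential q X s := by
  have h := natCast_mul_potential_mono q X hs
  rw [natCast_mul_potential, Finset.sum_range_one, distRatio_zero hx hqx] at h
  rwa [div_le_iff₀' (by exact_mod_cast hs)]

theorem potential_le_of_subset (hx : IsNearestNeighbor q X x) (hSX : S ⊆ X) (hxS : x ∈ S) :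
    potential q S S.card ≤ potential q X S.card :=
  mul_le_mul_of_nonneg_left (Finset.sum_le_sum fun i hi =>
    distRatio_le_of_subset hx hSX hxS (Finset.mem_range.1 hi)) (by positivity)

theorem sum_distRatio (hx : IsNearestNeighbor q X x) :
    ∑ i ∈ Finset.range X.card, distRatio q X i = ∑ y ∈ X, ‖q - x‖ / ‖q - y‖ := by
  have h := List.sum_range_getD (sortedDists q X) fun t => ‖q - x‖ / t
  have hl : (sortedDists q X).length = X.card := by simp [sortedDists]
  rw [hl] at h
  simp only [distRatio, sortedDists_getD_zero hx]
  rw [h, ← Multiset.sum_coe, ← Multiset.map_coe, sortedDists, Multiset.sort_eq, Multiset.map_map]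
  rfl

open scoped Classical in
theorem reducedPotential_card (hx : IsNearestNeighbor q X x) :
    reducedPotential q X X.card = 1 / (X.card : ℝ) * ∑ y ∈ X.erase x, ‖q - x‖ / ‖q - y‖ := by
  rw [reducedPotential]
  congr 1
  have h := sum_distRatio hx
  rw [← Finset.add_sum_erase _ _ hx.1, Finset.range_eq_Ico,
    Finset.sum_eq_sum_Ico_succ_bot (card_pos_of_isNearestNeighbor hx)] at h
  have h0 : distRatio q X 0 = ‖q - x‖ / ‖q - x‖ := by rw [distRatio, sortedDists_getD_zero hx]
  rw [h0] at h
  exact add_left_cancel h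

theorem potential_card_eq (hx : IsNearestNeighbor q X x) (hqx : q ≠ x) :
    potential q X X.card = 1 / (X.card : ℝ) + reducedPotential q X X.card := by
  rw [potential, reducedPotential, Finset.range_eq_Ico,
    Finset.sum_eq_sum_Ico_succ_bot (card_pos_of_isNearestNeighbor hx), distRatio_zero hx hqx]
  ring

theorem two_mul_reducedPotential_pair {q x y : RPSpace d} (hxy : x ≠ y)
    (h : ‖q - x‖ ≤ ‖q - y‖) :
    2 * reducedPotential q (pairCollection x y) 2 = ‖q - x‖ / ‖q - y‖ := by
  classical
  have hx : IsNearestNeighbor q (pairCollection x y) x := by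
    refine ⟨by simp [pairCollection], fun z hz => ?_⟩
    simp only [pairCollection, Finset.mem_insert, Finset.mem_singleton] at hz
    rcases hz with rfl | rfl
    exacts [le_rfl, h]
  have hc : (pairCollection x y).card = 2 := by simp [pairCollection, Finset.card_pair hxy]
  have he : (pairCollection x y).erase x = {y} := by
    ext z
    simp only [pairCollection, Finset.mem_erase, Finset.mem_insert, Finset.mem_singleton]
    constructor
    · tauto
    · rintro rfl; exact ⟨hxy.symm, Or.inr rfl⟩
  have h := reducedPotential_card hx
  rw [hc, he, Finset.sum_singleton] at h
  rw [h]; push_cast; ring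

end Potential

/-! ### The probability that a projection falls between two others -/

theorem projBetween_iff {d : ℕ} (u q x y : RPSpace d) :
    ProjBetween u q x y ↔ inner ℝ u (q - y) * inner ℝ u (x - y) ≤ 0 := by
  simp only [ProjBetween, inner_sub_right, mul_nonpos_iff, sub_nonneg, sub_nonpos]
  tauto

theorem measurableSet_projBetween {d : ℕ} (q x y : RPSpace d) :
    MeasurableSet {u : Metric.sphere (0 : RPSpace d) 1 | ProjBetween (u : RPSpace d) q x y} := by
  simp only [projBetween_iff]
  exact measurableSet_le (by fun_prop) measurable_const

theorem sphereUniform_real_projBetween {d : ℕ} [NeZero d] {q x y : RPSpace d} (hqy : q ≠ y)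
    (hxy : x ≠ y) :
    (sphereUniform d).real {u | ProjBetween (u : RPSpace d) q x y} =
      InnerProductGeometry.angle (q - y) (x - y) / Real.pi := by
  rw [← signChangeProb_eq_angle_div_pi (sub_ne_zero.2 hqy) (sub_ne_zero.2 hxy)]
  apply measureReal_congr
  rw [Filter.eventuallyEq_set]
  filter_upwards [sphereUniform_ae_inner_ne_zero (sub_ne_zero.2 hqy),
    sphereUniform_ae_inner_ne_zero (sub_ne_zero.2 hxy)] with u h1 h2
  simp only [projBetween_iff]
  exact ⟨fun h => lt_of_le_of_ne h (mul_ne_zero h1 h2), le_of_lt⟩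

theorem sphereUniform_real_projBetween_eq_arcsin {d : ℕ} [NeZero d] {q x y : RPSpace d}
    (hqx : q ≠ x) (hxy : x ≠ y) (h : ‖q - x‖ ≤ ‖q - y‖) :
    (sphereUniform d).real {u | ProjBetween (u : RPSpace d) q x y} =
      1 / Real.pi * Real.arcsin (‖q - x‖ / ‖q - y‖ *
        √(1 - (inner ℝ (q - x) (y - x) / (‖q - x‖ * ‖y - x‖)) ^ 2)) := by
  have hpx : 0 < ‖q - x‖ := norm_pos_iff.2 (sub_ne_zero.2 hqx)
  have hpy : 0 < ‖q - y‖ := hpx.trans_le h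
  have hqy : q ≠ y := sub_ne_zero.1 (norm_pos_iff.1 hpy)
  rw [sphereUniform_real_projBetween hqy hxy]
  have hsin : √(1 - (inner ℝ (q - x) (y - x) / (‖q - x‖ * ‖y - x‖)) ^ 2) =
      Real.sin (InnerProductGeometry.angle (q - x) (y - x)) := by
    rw [← InnerProductGeometry.cos_angle, ← Real.sin_sq, Real.sqrt_sq
      (InnerProductGeometry.sin_angle_nonneg _ _)]
  have hlaw := EuclideanGeometry.sin_angle_mul_dist_eq_sin_angle_mul_dist x y q
  simp only [EuclideanGeometry.angle, vsub_eq_sub, dist_eq_norm] at hlaw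
  rw [InnerProductGeometry.angle_comm (x - y), norm_sub_rev y q] at hlaw
  have hle : InnerProductGeometry.angle (q - y) (x - y) ≤ Real.pi / 2 := by
    rw [InnerProductGeometry.angle, Real.arccos_le_pi_div_two]
    refine div_nonneg ?_ (by positivity)
    have h1 := norm_sub_sq_real (q - y) (x - y)
    rw [sub_sub_sub_cancel_right] at h1
    nlinarith [sq_nonneg ‖x - y‖, norm_nonneg (q - x)]
  have harg : ‖q - x‖ / ‖q - y‖ * Real.sin (InnerProductGeometry.angle (q - x) (y - x)) =
      Real.sin (InnerProductGeometry.angle (q - y) (x - y)) := by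
    rw [div_mul_eq_mul_div, mul_comm ‖q - x‖, ← hlaw, mul_div_cancel_right₀ _ hpy.ne']
  rw [hsin, harg, Real.arcsin_sin (by
    linarith [InnerProductGeometry.angle_nonneg (q - y) (x - y), Real.pi_pos]) hle]
  ring

theorem Real.arcsin_le_pi_div_two_mul {t : ℝ} (h0 : 0 ≤ t) (h1 : t ≤ 1) :
    Real.arcsin t ≤ Real.pi / 2 * t := by
  have h := Real.mul_le_sin (Real.arcsin_nonneg.2 h0) (Real.arcsin_le_pi_div_two t)
  rw [Real.sin_arcsin (by linarith) h1, div_mul_eq_mul_div, div_le_iff₀ Real.pi_pos] at h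
  linarith

theorem sphereUniform_real_projBetween_le {d : ℕ} [NeZero d] {q x y : RPSpace d} (hxy : x ≠ y)
    (h : ‖q - x‖ ≤ ‖q - y‖) :
    (sphereUniform d).real {u | ProjBetween (u : RPSpace d) q x y} ≤
      1 / 2 * (‖q - x‖ / ‖q - y‖) := by
  rcases eq_or_ne q x with rfl | hqx
  · rw [sphereUniform_real_projBetween hxy hxy, InnerProductGeometry.angle_self
      (sub_ne_zero.2 hxy)]
    simp
  · rw [sphereUniform_real_projBetween_eq_arcsin hqx hxy h]
    have hr0 : 0 ≤ ‖q - x‖ / ‖q - y‖ := by positivity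
    have hr1 : ‖q - x‖ / ‖q - y‖ ≤ 1 := div_le_one_of_le₀ h (norm_nonneg _)
    have hs1 : √(1 - (inner ℝ (q - x) (y - x) / (‖q - x‖ * ‖y - x‖)) ^ 2) ≤ 1 :=
      Real.sqrt_le_one.2 (by linarith [sq_nonneg (inner ℝ (q - x) (y - x) / (‖q - x‖ * ‖y - x‖))])
    have hle := mul_le_of_le_one_right hr0 hs1
    have h2 := Real.arcsin_le_pi_div_two_mul hr0 hr1
    have h3 := Real.arcsin_le_arcsin hle
    rw [div_mul_eq_mul_div, one_mul, div_le_iff₀ Real.pi_pos]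
    linarith

section Fraction

variable {d : ℕ} {q x : RPSpace d} {X : Finset (RPSpace d)}

open scoped Classical in
theorem fractionBetween_eq_sum (q : RPSpace d) (X : Finset (RPSpace d)) (x u : RPSpace d) :
    fractionBetween q X x u =
      (∑ y ∈ X.erase x, if ProjBetween u q x y then (1 : ℝ) else 0) / X.card := by
  rw [fractionBetween, Finset.sum_boole]
  congr 3
  ext y
  simp only [Finset.mem_filter, Finset.mem_erase]
  tauto

open scoped Classical in
theorem integrable_ite_projBetween [NeZero d] (q x y : RPSpace d) :
    Integrable (fun u : Metric.sphere (0 : RPSpace d) 1 =>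
      if ProjBetween (u : RPSpace d) q x y then (1 : ℝ) else 0) (sphereUniform d) := by
  have h : (fun u : Metric.sphere (0 : RPSpace d) 1 =>
      if ProjBetween (u : RPSpace d) q x y then (1 : ℝ) else 0) =
        Set.indicator {u : Metric.sphere (0 : RPSpace d) 1 | ProjBetween (u : RPSpace d) q x y}
          fun _ => (1 : ℝ) := by
    ext u; simp [Set.indicator_apply]
  rw [h]
  exact (integrable_const (1 : ℝ)).indicator (measurableSet_projBetween q x y)

open scoped Classical in
theorem integral_ite_projBetween [NeZero d] (q x y : RPSpace d) :
    ∫ u : Metric.sphere (0 : RPSpace d) 1,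
      (if ProjBetween (u : RPSpace d) q x y then (1 : ℝ) else 0) ∂(sphereUniform d) =
        (sphereUniform d).real {u | ProjBetween (u : RPSpace d) q x y} := by
  rw [← integral_indicator_one (measurableSet_projBetween q x y)]
  congr 1

theorem integrable_fractionBetween [NeZero d] (q : RPSpace d) (X : Finset (RPSpace d))
    (x : RPSpace d) :
    Integrable (fun u : Metric.sphere (0 : RPSpace d) 1 => fractionBetween q X x (u : RPSpace d))
      (sphereUniform d) := by
  simp only [fractionBetween_eq_sum]
  exact (integrable_finsetSum _ fun y _ => integrable_ite_projBetween q x y).div_const _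

theorem integral_fractionBetween_le [NeZero d] (hx : IsNearestNeighbor q X x) :
    ∫ u, fractionBetween q X x (u : RPSpace d) ∂(sphereUniform d) ≤
      1 / 2 * reducedPotential q X X.card := by
  classical
  simp only [fractionBetween_eq_sum]
  rw [integral_div, integral_finsetSum _ fun y _ => integrable_ite_projBetween q x y,
    reducedPotential_card hx]
  simp only [integral_ite_projBetween]
  have h := Finset.sum_le_sum fun y (hy : y ∈ X.erase x) =>
    sphereUniform_real_projBetween_le (Finset.ne_of_mem_erase hy).symm
      (hx.2 y (Finset.mem_of_mem_erase hy))
  rw [← Finset.mul_sum] at h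
  have h2 := div_le_div_of_nonneg_right h (Nat.cast_nonneg (α := ℝ) X.card)
  refine h2.trans_eq ?_
  ring

end Fraction

/-! ### The random split at a node -/

section Fractile

variable {d : ℕ} {u : RPSpace d} {b : ℝ} {S : Finset (RPSpace d)}

theorem fractileRank_sub_one_lt (b : ℝ) {s : ℕ} (hs : 0 < s) : fractileRank b s - 1 < s := by
  have := min_le_right ⌈b * s⌉₊ (s - 1)
  unfold fractileRank
  omega

theorem fractile_lt_iff (hS : S.Nonempty) (t : ℝ) :
    fractile u b S < t ↔
      fractileRank b S.card - 1 < (S.filter fun w => inner ℝ u w < t).card := by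
  rw [fractile, Multiset.sort_getD_iff (p := fun a => a < t) (fun a b h => h.trans_lt)
    (by simpa using fractileRank_sub_one_lt b hS.card_pos), Multiset.countP_map]
  rfl

theorem fractile_le_iff (hS : S.Nonempty) (t : ℝ) :
    fractile u b S ≤ t ↔
      fractileRank b S.card - 1 < (S.filter fun w => inner ℝ u w ≤ t).card := by
  rw [fractile, Multiset.sort_getD_iff (p := fun a => a ≤ t) (fun a b h => h.trans)
    (by simpa using fractileRank_sub_one_lt b hS.card_pos), Multiset.countP_map]
  rfl

theorem fractileRank_eq_ceil (hb : b ∈ Set.Icc (1 / 4 : ℝ) (3 / 4)) {s : ℕ} (hs : 4 ≤ s) :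
    fractileRank b s = ⌈b * s⌉₊ := by
  apply min_eq_left
  rw [Nat.ceil_le, Nat.cast_sub (by omega)]
  have hs' : (4 : ℝ) ≤ s := by exact_mod_cast hs
  have := mul_le_mul_of_nonneg_right hb.2 (Nat.cast_nonneg (α := ℝ) s)
  push_cast
  linarith

theorem le_four_mul_fractileRank (hb : b ∈ Set.Icc (1 / 4 : ℝ) (3 / 4)) {s : ℕ} (hs : 4 ≤ s) :
    s ≤ 4 * fractileRank b s := by
  rw [fractileRank_eq_ceil hb hs]
  have h := Nat.le_ceil (b * s)
  have := mul_le_mul_of_nonneg_right hb.1 (Nat.cast_nonneg (α := ℝ) s)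
  have h2 : (s : ℝ) ≤ 4 * (⌈b * s⌉₊ : ℝ) := by linarith
  exact_mod_cast h2

theorem four_mul_fractileRank_le (hb : b ∈ Set.Icc (1 / 4 : ℝ) (3 / 4)) {s : ℕ} (hs : 4 ≤ s) :
    4 * fractileRank b s ≤ 3 * s + 3 := by
  rw [fractileRank_eq_ceil hb hs]
  have h : ⌈b * s⌉₊ ≤ (3 * s + 3) / 4 := by
    rw [Nat.ceil_le]
    have h1 : 3 * s ≤ 4 * ((3 * s + 3) / 4) := by omega
    have h2 : (3 : ℝ) * s ≤ 4 * (((3 * s + 3) / 4 : ℕ) : ℝ) := by exact_mod_cast h1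
    have := mul_le_mul_of_nonneg_right hb.2 (Nat.cast_nonneg (α := ℝ) s)
    linarith
  omega

theorem card_leftPart_le (hb : b ∈ Set.Icc (1 / 4 : ℝ) (3 / 4)) (hs : 4 ≤ S.card)
    (hinj : ∀ y ∈ S, ∀ z ∈ S, inner ℝ u y = inner ℝ u z → y = z) :
    4 * (leftPart u (fractile u b S) S).card ≤ 3 * S.card + 3 := by
  classical
  have hS : S.Nonempty := Finset.card_pos.1 (by omega)
  have h1 := (fractile_lt_iff (u := u) (b := b) hS (fractile u b S)).not.1 (lt_irrefl _)
  have h2 : leftPart u (fractile u b S) S ⊆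
      (S.filter fun w => inner ℝ u w < fractile u b S) ∪
        (S.filter fun w => inner ℝ u w = fractile u b S) := by
    intro v hv
    simp only [leftPart, Finset.mem_filter, Finset.mem_union] at hv ⊢
    rcases hv.2.lt_or_eq with h | h
    exacts [Or.inl ⟨hv.1, h⟩, Or.inr ⟨hv.1, h⟩]
  have h3 : (S.filter fun w => inner ℝ u w = fractile u b S).card ≤ 1 := by
    rw [Finset.card_le_one]
    intro y hy z hz
    simp only [Finset.mem_filter] at hy hz
    exact hinj y hy.1 z hz.1 (hy.2.trans hz.2.symm)
  have h4 := (Finset.card_le_card h2).trans (Finset.card_union_le _ _)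
  have h5 := le_four_mul_fractileRank hb hs
  have h6 := four_mul_fractileRank_le hb hs
  omega

theorem card_rightPart_le (hb : b ∈ Set.Icc (1 / 4 : ℝ) (3 / 4)) (hs : 4 ≤ S.card) :
    4 * (rightPart u (fractile u b S) S).card ≤ 3 * S.card + 3 := by
  classical
  have hS : S.Nonempty := Finset.card_pos.1 (by omega)
  have h1 := (fractile_le_iff (u := u) (b := b) hS (fractile u b S)).1 le_rfl
  have h2 := S.card_filter_add_card_filter_not (fun w => inner ℝ u w ≤ fractile u b S)
  have h3 : rightPart u (fractile u b S) S =
      S.filter fun w => ¬ inner ℝ u w ≤ fractile u b S := by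
    simp only [rightPart, not_le]
  have h5 := le_four_mul_fractileRank hb hs
  rw [h3]
  omega

theorem measurable_card_filter_inner_lt {α : Type*} [MeasurableSpace α] {f : α → RPSpace d}
    (hf : Measurable f) {g : α → ℝ} (hg : Measurable g) (S : Finset (RPSpace d)) :
    Measurable fun p => (S.filter fun w => inner ℝ (f p) w < g p).card := by
  simp only [Finset.card_filter]
  exact Finset.measurable_sum _ fun w _ =>
    Measurable.ite (measurableSet_lt (by fun_prop) hg) measurable_const measurable_const

theorem measurable_fractileRank (s : ℕ) : Measurable fun b => fractileRank b s :=
  (Nat.measurable_ceil.comp (measurable_id.mul_const (s : ℝ))).min measurable_const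

theorem measurable_fractile (hS : S.Nonempty) :
    Measurable fun p : Metric.sphere (0 : RPSpace d) 1 × ℝ => fractile (p.1 : RPSpace d) p.2 S := by
  refine measurable_of_Iio fun t => ?_
  have h : (fun p : Metric.sphere (0 : RPSpace d) 1 × ℝ =>
      fractile (p.1 : RPSpace d) p.2 S) ⁻¹' Set.Iio t =
        {p | fractileRank p.2 S.card - 1 <
          (S.filter fun w => inner ℝ (p.1 : RPSpace d) w < t).card} := by
    ext p
    exact fractile_lt_iff hS t
  rw [h]
  have hr : Measurable fun p : Metric.sphere (0 : RPSpace d) 1 × ℝ =>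
      fractileRank p.2 S.card - 1 :=
    (measurable_from_top (f := fun n : ℕ => n - 1)).comp
      ((measurable_fractileRank S.card).comp measurable_snd)
  exact measurableSet_lt hr (measurable_card_filter_inner_lt (by fun_prop) measurable_const S)

theorem measurableSet_inner_le_fractile (hS : S.Nonempty) (z : RPSpace d) :
    MeasurableSet {p : Metric.sphere (0 : RPSpace d) 1 × ℝ |
      inner ℝ (p.1 : RPSpace d) z ≤ fractile (p.1 : RPSpace d) p.2 S} :=
  measurableSet_le (by fun_prop) (measurable_fractile hS)

end Fractile

/-- A random rank falls into a given interval with at most twice the proportional probability. -/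
theorem cond_fractileRank_le {s : ℕ} (hs : 4 ≤ s) {i j : ℕ} (hij : i ≤ j) :
    ProbabilityTheory.cond (volume : Measure ℝ) (Set.Icc (1 / 4 : ℝ) (3 / 4))
      {b | i ≤ fractileRank b s - 1 ∧ fractileRank b s - 1 < j} ≤
        ENNReal.ofReal (2 / s * ((j - i : ℕ) : ℝ)) := by
  have hs' : (0 : ℝ) < s := by exact_mod_cast (by omega : 0 < s)
  rw [ProbabilityTheory.cond_apply measurableSet_Icc, Real.volume_Icc]
  have hsub : Set.Icc (1 / 4 : ℝ) (3 / 4) ∩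
      {b | i ≤ fractileRank b s - 1 ∧ fractileRank b s - 1 < j} ⊆
        Set.Ioc ((i : ℝ) / s) ((j : ℝ) / s) := by
    rintro b ⟨hb, h1, h2⟩
    have h3 := le_four_mul_fractileRank hb hs
    rw [fractileRank_eq_ceil hb hs] at h1 h2 h3
    constructor
    · rw [div_lt_iff₀ hs', ← Nat.lt_ceil]; omega
    · rw [le_div_iff₀ hs', ← Nat.ceil_le]; omega
  refine (mul_le_mul_right (measure_mono hsub) _).trans ?_
  rw [Real.volume_Ioc, ← ENNReal.ofReal_inv_of_pos (by norm_num),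
    ← ENNReal.ofReal_mul (by norm_num), Nat.cast_sub hij]
  apply ENNReal.ofReal_le_ofReal
  apply le_of_eq
  field_simp
  ring

/-- The choices at a node that separate `q` and `x`. -/
def separatingChoices {d : ℕ} (q x : RPSpace d) (S : Finset (RPSpace d)) :
    Set (Metric.sphere (0 : RPSpace d) 1 × ℝ) :=
  {p | ¬ (inner ℝ (p.1 : RPSpace d) q ≤ fractile (p.1 : RPSpace d) p.2 S ↔
    inner ℝ (p.1 : RPSpace d) x ≤ fractile (p.1 : RPSpace d) p.2 S)}

section Separation

variable {d : ℕ} {q x : RPSpace d} {S : Finset (RPSpace d)}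

theorem measurableSet_separatingChoices (hS : S.Nonempty) (q x : RPSpace d) :
    MeasurableSet (separatingChoices q x S) := by
  have hq := measurableSet_inner_le_fractile hS q
  have hx := measurableSet_inner_le_fractile hS x
  have h : separatingChoices q x S =
      ({p | inner ℝ (p.1 : RPSpace d) q ≤ fractile (p.1 : RPSpace d) p.2 S} \
        {p | inner ℝ (p.1 : RPSpace d) x ≤ fractile (p.1 : RPSpace d) p.2 S}) ∪
      ({p | inner ℝ (p.1 : RPSpace d) x ≤ fractile (p.1 : RPSpace d) p.2 S} \
        {p | inner ℝ (p.1 : RPSpace d) q ≤ fractile (p.1 : RPSpace d) p.2 S}) := by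
    ext p
    simp only [separatingChoices, Set.mem_ofPred_eq, Set.mem_union, Set.mem_sdiff]
    tauto
  rw [h]
  exact (hq.diff hx).union (hx.diff hq)

theorem card_filter_lt_sub_le {u : RPSpace d} (S : Finset (RPSpace d)) {s t : ℝ} :
    (S.filter fun w => inner ℝ u w < t).card - (S.filter fun w => inner ℝ u w < s).card ≤
      (S.filter fun w => s ≤ inner ℝ u w ∧ inner ℝ u w < t).card := by
  classical
  have h : (S.filter fun w => inner ℝ u w < t) ⊆ (S.filter fun w => inner ℝ u w < s) ∪
      (S.filter fun w => s ≤ inner ℝ u w ∧ inner ℝ u w < t) := by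
    intro w hw
    simp only [Finset.mem_filter, Finset.mem_union] at hw ⊢
    rcases lt_or_ge (inner ℝ u w) s with h | h
    exacts [Or.inl ⟨hw.1, h⟩, Or.inr ⟨hw.1, h, hw.2⟩]
  have := (Finset.card_le_card h).trans (Finset.card_union_le _ _)
  omega

open scoped Classical in
theorem cond_separatingChoices_le (hs : 4 ≤ S.card) (q x : RPSpace d)
    (u : Metric.sphere (0 : RPSpace d) 1) :
    ProbabilityTheory.cond (volume : Measure ℝ) (Set.Icc (1 / 4 : ℝ) (3 / 4))
      (Prod.mk u ⁻¹' separatingChoices q x S) ≤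
        ENNReal.ofReal (2 * fractionBetween q S x (u : RPSpace d) + 2 / S.card *
          (if inner ℝ (u : RPSpace d) x < inner ℝ (u : RPSpace d) q then (1 : ℝ) else 0)) := by
  have hS : S.Nonempty := Finset.card_pos.1 (by omega)
  have hs' : (0 : ℝ) < S.card := by exact_mod_cast (by omega : 0 < S.card)
  set N : RPSpace d → ℕ := fun z =>
    (S.filter fun w => inner ℝ (u : RPSpace d) w < inner ℝ (u : RPSpace d) z).card with hN
  have hmono : ∀ y z, inner ℝ (u : RPSpace d) y ≤ inner ℝ (u : RPSpace d) z → N y ≤ N z :=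
    fun y z h => Finset.card_le_card (Finset.monotone_filter_right _ fun w _ hw => hw.trans_le h)
  have hle : ∀ (b : ℝ) z, inner ℝ (u : RPSpace d) z ≤ fractile (u : RPSpace d) b S ↔
      N z ≤ fractileRank b S.card - 1 := fun b z => by
    rw [← not_lt, fractile_lt_iff hS, not_lt]
  have hfrac : fractionBetween q S x (u : RPSpace d) * S.card =
      (S.filter fun y => y ≠ x ∧ ProjBetween (u : RPSpace d) q x y).card := by
    rw [fractionBetween, div_mul_cancel₀ _ hs'.ne']
  rcases le_or_gt (inner ℝ (u : RPSpace d) q) (inner ℝ (u : RPSpace d) x) with h | h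
  · rw [if_neg h.not_gt]
    refine (measure_mono ?_).trans ((cond_fractileRank_le hs (hmono q x h)).trans
      (ENNReal.ofReal_le_ofReal ?_))
    · intro b hb
      simp only [separatingChoices, Set.mem_preimage, Set.mem_ofPred_eq, hle] at hb ⊢
      have := hmono q x h
      omega
    · have h1 : N x - N q ≤
          (S.filter fun y => y ≠ x ∧ ProjBetween (u : RPSpace d) q x y).card := by
        refine (card_filter_lt_sub_le S).trans (Finset.card_le_card
          (Finset.monotone_filter_right _ fun w _ hw => ⟨?_, Or.inl ⟨hw.1, hw.2.le⟩⟩))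
        rintro rfl
        exact lt_irrefl _ hw.2
      have h2 : ((N x - N q : ℕ) : ℝ) ≤ fractionBetween q S x (u : RPSpace d) * S.card := by
        rw [hfrac]; exact_mod_cast h1
      rw [div_mul_eq_mul_div, div_le_iff₀ hs']
      linarith
  · rw [if_pos h]
    refine (measure_mono ?_).trans ((cond_fractileRank_le hs (hmono x q h.le)).trans
      (ENNReal.ofReal_le_ofReal ?_))
    · intro b hb
      simp only [separatingChoices, Set.mem_preimage, Set.mem_ofPred_eq, hle] at hb ⊢
      have := hmono x q h.le
      omega
    · have h1 : N q - N x ≤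
          (S.filter fun y => y ≠ x ∧ ProjBetween (u : RPSpace d) q x y).card + 1 := by
        refine (card_filter_lt_sub_le S).trans ((Finset.card_le_card (t := insert x
          (S.filter fun y => y ≠ x ∧ ProjBetween (u : RPSpace d) q x y)) ?_).trans
            (Finset.card_insert_le _ _))
        intro w hw
        simp only [Finset.mem_filter, Finset.mem_insert] at hw ⊢
        by_cases hwx : w = x
        · exact Or.inl hwx
        · exact Or.inr ⟨hw.1, hwx, Or.inr ⟨hw.2.1, hw.2.2.le⟩⟩
      have h2 : ((N q - N x : ℕ) : ℝ) ≤ fractionBetween q S x (u : RPSpace d) * S.card + 1 := by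
        rw [hfrac]; exact_mod_cast h1
      rw [div_mul_eq_mul_div, div_le_iff₀ hs', add_mul, div_mul_eq_mul_div, div_mul_cancel₀ _ hs'.ne']
      linarith

theorem sphereUniform_real_inner_lt_le [NeZero d] (q x : RPSpace d) :
    (sphereUniform d).real {u : Metric.sphere (0 : RPSpace d) 1 |
      inner ℝ (u : RPSpace d) x < inner ℝ (u : RPSpace d) q} ≤ 1 / 2 := by
  have hm : ∀ v : RPSpace d, MeasurableSet {z : RPSpace d | inner ℝ z v < 0} := fun v =>
    measurableSet_lt (by fun_prop) measurable_const
  have h := sphereUniform_real_comp_isometry (hm (q - x)) (fun r hr z => by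
    simp [inner_smul_left, mul_neg_iff, hr, hr.not_gt]) (LinearIsometryEquiv.neg ℝ)
  have h1 : {u : Metric.sphere (0 : RPSpace d) 1 |
      inner ℝ (u : RPSpace d) x < inner ℝ (u : RPSpace d) q} =
      {u : Metric.sphere (0 : RPSpace d) 1 | (LinearIsometryEquiv.neg ℝ) (u : RPSpace d) ∈
        {z : RPSpace d | inner ℝ z (q - x) < 0}} := by
    ext u
    simp [inner_sub_right]
  have hd : Disjoint {u : Metric.sphere (0 : RPSpace d) 1 |
      inner ℝ (u : RPSpace d) x < inner ℝ (u : RPSpace d) q}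
      {u : Metric.sphere (0 : RPSpace d) 1 | (u : RPSpace d) ∈ {z : RPSpace d | inner ℝ z (q - x) < 0}} := by
    rw [Set.disjoint_left]
    intro u hu hu'
    simp only [Set.mem_ofPred_eq, inner_sub_right] at hu hu'
    linarith
  have h2 := measureReal_union (μ := sphereUniform d) hd (measurable_subtype_coe (hm (q - x)))
  have h3 := measureReal_le_one (μ := sphereUniform d) (s := {u : Metric.sphere (0 : RPSpace d) 1 |
      inner ℝ (u : RPSpace d) x < inner ℝ (u : RPSpace d) q} ∪
      {u : Metric.sphere (0 : RPSpace d) 1 | (u : RPSpace d) ∈ {z : RPSpace d | inner ℝ z (q - x) < 0}})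
  rw [← h1] at h
  change _ = _ + (sphereUniform d).real
    {u : Metric.sphere (0 : RPSpace d) 1 | (u : RPSpace d) ∈ {z : RPSpace d | inner ℝ z (q - x) < 0}} at h2
  rw [← h] at h2
  linarith

theorem nodeLaw_separatingChoices_le [NeZero d] (hs : 4 ≤ S.card)
    (hx : IsNearestNeighbor q S x) :
    nodeLaw d (separatingChoices q x S) ≤ ENNReal.ofReal (potential q S S.card) := by
  classical
  rcases eq_or_ne q x with rfl | hqx
  · have : separatingChoices q q S = ∅ := by ext p; simp [separatingChoices]
    simp [this]
  have hS : S.Nonempty := ⟨x, hx.1⟩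
  have hs' : (0 : ℝ) < S.card := by exact_mod_cast (by omega : 0 < S.card)
  have hm : MeasurableSet {u : Metric.sphere (0 : RPSpace d) 1 |
      inner ℝ (u : RPSpace d) x < inner ℝ (u : RPSpace d) q} :=
    measurableSet_lt (by fun_prop) (by fun_prop)
  have hind : (fun u : Metric.sphere (0 : RPSpace d) 1 =>
      if inner ℝ (u : RPSpace d) x < inner ℝ (u : RPSpace d) q then (1 : ℝ) else 0) =
        Set.indicator {u : Metric.sphere (0 : RPSpace d) 1 |
          inner ℝ (u : RPSpace d) x < inner ℝ (u : RPSpace d) q} 1 := by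
    ext u; simp [Set.indicator_apply]
  have hint1 := integrable_fractionBetween q S x
  have hint2 : Integrable (fun u : Metric.sphere (0 : RPSpace d) 1 =>
      if inner ℝ (u : RPSpace d) x < inner ℝ (u : RPSpace d) q then (1 : ℝ) else 0)
      (sphereUniform d) := by
    rw [hind]
    exact (integrable_const (1 : ℝ)).indicator hm
  have hnonneg : ∀ u : Metric.sphere (0 : RPSpace d) 1,
      0 ≤ 2 * fractionBetween q S x (u : RPSpace d) + 2 / S.card *
        (if inner ℝ (u : RPSpace d) x < inner ℝ (u : RPSpace d) q then (1 : ℝ) else 0) := fun u => by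
    have : 0 ≤ fractionBetween q S x (u : RPSpace d) := by unfold fractionBetween; positivity
    positivity
  have : IsProbabilityMeasure
      (ProbabilityTheory.cond (volume : Measure ℝ) (Set.Icc (1 / 4 : ℝ) (3 / 4))) := by
    apply ProbabilityTheory.cond_isProbabilityMeasure_of_finite
    · rw [Real.volume_Icc]; norm_num
    · rw [Real.volume_Icc]; exact ENNReal.ofReal_ne_top
  rw [nodeLaw, Measure.prod_apply (measurableSet_separatingChoices hS q x)]
  refine (lintegral_mono fun u => cond_separatingChoices_le hs q x u).trans ?_
  rw [← ofReal_integral_eq_lintegral_ofReal (f := fun u : Metric.sphere (0 : RPSpace d) 1 =>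
      2 * fractionBetween q S x (u : RPSpace d) + 2 / S.card *
        (if inner ℝ (u : RPSpace d) x < inner ℝ (u : RPSpace d) q then (1 : ℝ) else 0))
    ((hint1.const_mul 2).add (hint2.const_mul _)) (Filter.Eventually.of_forall hnonneg)]
  apply ENNReal.ofReal_le_ofReal
  rw [integral_add (hint1.const_mul 2) (hint2.const_mul _), integral_const_mul, integral_const_mul,
    hind, integral_indicator_one hm, potential_card_eq hx hqx]
  have h1 := integral_fractionBetween_le hx
  have h2 := mul_le_mul_of_nonneg_left (sphereUniform_real_inner_lt_le q x)
    (by positivity : 0 ≤ 2 / (S.card : ℝ))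
  have h3 : 2 / (S.card : ℝ) * (1 / 2) = 1 / S.card := by ring
  linarith

theorem ae_projections_injective [NeZero d] (S : Finset (RPSpace d)) :
    ∀ᵐ u : Metric.sphere (0 : RPSpace d) 1 ∂(sphereUniform d),
      ∀ y ∈ S, ∀ z ∈ S, inner ℝ (u : RPSpace d) y = inner ℝ (u : RPSpace d) z → y = z := by
  rw [Finset.eventually_all]
  intro y hy
  rw [Finset.eventually_all]
  intro z hz
  rcases eq_or_ne y z with rfl | hyz
  · simp
  · filter_upwards [sphereUniform_ae_inner_ne_zero (sub_ne_zero.2 hyz)] with u hu h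
    rw [inner_sub_right, sub_ne_zero] at hu
    exact absurd h hu

theorem nodeLaw_ae_regular [NeZero d] (S : Finset (RPSpace d)) :
    ∀ᵐ p ∂(nodeLaw d), (∀ y ∈ S, ∀ z ∈ S,
      inner ℝ (p.1 : RPSpace d) y = inner ℝ (p.1 : RPSpace d) z → y = z) ∧
        p.2 ∈ Set.Icc (1 / 4 : ℝ) (3 / 4) := by
  have h2 : ∀ᵐ b ∂(ProbabilityTheory.cond (volume : Measure ℝ) (Set.Icc (1 / 4 : ℝ) (3 / 4))),
      b ∈ Set.Icc (1 / 4 : ℝ) (3 / 4) := ProbabilityTheory.ae_cond_mem measurableSet_Icc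
  have h1 := ae_projections_injective S
  have : SFinite (ProbabilityTheory.cond (volume : Measure ℝ) (Set.Icc (1 / 4 : ℝ) (3 / 4))) := by
    unfold ProbabilityTheory.cond; infer_instance
  exact (Measure.quasiMeasurePreserving_fst.ae h1).and (Measure.quasiMeasurePreserving_snd.ae h2)

end Separation

/-! ### Recursion for the failure probability -/

section Recursion

variable {d : ℕ}

/-- The choices at the root are independent of those in a subtree, and the latter have the same
law as the choices in the whole tree. -/
theorem treeLaw_root_inter_subtree [NeZero d] (c : Bool)
    {A : Set (Metric.sphere (0 : RPSpace d) 1 × ℝ)} (hA : MeasurableSet A) {F : Set (TreeSeed d)} (hF : MeasurableSet F) :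
    treeLaw d {ω | ω [] ∈ A ∧ (fun a => ω (c :: a)) ∈ F} = nodeLaw d A * treeLaw d F := by
  have hsub : Measurable fun (ω : TreeSeed d) (a : List Bool) => ω (c :: a) := by fun_prop
  have hev : treeLaw d {ω | ω [] ∈ A} = nodeLaw d A :=
    (measurePreserving_eval_infinitePi (fun _ : List Bool => nodeLaw d) []).measure_preimage
      hA.nullMeasurableSet
  rcases eq_or_ne (nodeLaw d A) 0 with h0 | h0
  · rw [h0, zero_mul]
    exact measure_mono_null (fun ω hω => hω.1) (hev.trans h0)
  have htop : nodeLaw d A ≠ ⊤ := measure_ne_top _ _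
  have key : (nodeLaw d A)⁻¹ • ((treeLaw d).restrict {ω | ω [] ∈ A}).map
      (fun (ω : TreeSeed d) (a : List Bool) => ω (c :: a)) = treeLaw d := by
    refine Measure.eq_infinitePi _ fun s t ht => ?_
    have hpi : MeasurableSet (Set.pi (s : Set (List Bool)) t) :=
      .pi s.countable_toSet fun i _ => ht i
    rw [Measure.smul_apply, Measure.map_apply hsub hpi, Measure.restrict_apply (hsub hpi)]
    let t' : List Bool → Set (Metric.sphere (0 : RPSpace d) 1 × ℝ) := fun l => l.casesOn A
      fun _ l => t l
    have hbox : (fun (ω : TreeSeed d) (a : List Bool) => ω (c :: a)) ⁻¹' Set.pi s t ∩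
        {ω | ω [] ∈ A} = Set.pi
          (insert [] (s.map ⟨List.cons c, List.cons_injective⟩) : Finset (List Bool)) t' := by
      ext ω
      simp only [Set.mem_inter_iff, Set.mem_preimage, Set.mem_pi, Finset.mem_coe,
        Set.mem_ofPred_eq, Finset.mem_insert, Finset.mem_map, Function.Embedding.coeFn_mk]
      constructor
      · rintro ⟨h1, h2⟩ i (rfl | ⟨a, ha, rfl⟩)
        exacts [h2, h1 a ha]
      · exact fun h => ⟨fun a ha => h (c :: a) (Or.inr ⟨a, ha, rfl⟩), h [] (Or.inl rfl)⟩
    rw [hbox, treeLaw, Measure.infinitePi_pi, Finset.prod_insert (by simp), Finset.prod_map,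
      smul_eq_mul]
    · change (nodeLaw d A)⁻¹ * (nodeLaw d A * _) = _
      rw [← mul_assoc, ENNReal.inv_mul_cancel h0 htop, one_mul]
      rfl
    · intro i _
      cases i with
      | nil => exact hA
      | cons _ l => exact ht l
  have h := congrArg (fun μ => nodeLaw d A * μ F) key
  simp only [Measure.smul_apply, smul_eq_mul] at h
  rw [← mul_assoc, ENNReal.mul_inv_cancel h0 htop, one_mul, Measure.map_apply hsub hF,
    Measure.restrict_apply (hsub hF)] at h
  rw [← h]
  congr 1
  ext ω
  exact and_comm

theorem treeLaw_root_inter_subtree_le [NeZero d] (c : Bool)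
    {A : Set (Metric.sphere (0 : RPSpace d) 1 × ℝ)} (hA : MeasurableSet A)
    (F : Set (TreeSeed d)) :
    treeLaw d {ω | ω [] ∈ A ∧ (fun a => ω (c :: a)) ∈ F} ≤ nodeLaw d A * treeLaw d F := by
  rw [← measure_toMeasurable F,
    ← treeLaw_root_inter_subtree c hA (measurableSet_toMeasurable (treeLaw d) F)]
  exact measure_mono fun ω hω => ⟨hω.1, subset_toMeasurable _ _ hω.2⟩

/-- The choices for which the search for `q` ends in a leaf without `x`. -/
def missingSeeds (q x : RPSpace d) (m₀ : ℕ) (S : Finset (RPSpace d)) : Set (TreeSeed d) :=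
  {ω | x ∉ defeatistLeaf q (rpTree m₀ S ω)}

theorem defeatistLeaf_rpTree_subset (q : RPSpace d) (m₀ : ℕ) (S : Finset (RPSpace d))
    (ω : TreeSeed d) : defeatistLeaf q (rpTree m₀ S ω) ⊆ S := by
  induction hn : S.card using Nat.strong_induction_on generalizing S ω with
  | _ n ih =>
    rw [rpTree]
    split_ifs with h
    · rw [defeatistLeaf]
      split_ifs
      · exact (ih _ (hn ▸ h.2.1) _ _ rfl).trans (Finset.filter_subset _ _)
      · exact (ih _ (hn ▸ h.2.2) _ _ rfl).trans (Finset.filter_subset _ _)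
    · exact Finset.Subset.refl _

theorem defeatistFinds_of_mem {q x : RPSpace d} {m₀ : ℕ} {X : Finset (RPSpace d)}
    (hx : IsNearestNeighbor q X x) {ω : TreeSeed d} (h : x ∈ defeatistLeaf q (rpTree m₀ X ω)) :
    DefeatistFinds q (rpTree m₀ X ω) x :=
  hx.mono (defeatistLeaf_rpTree_subset q m₀ X ω) h

theorem missingSeeds_eq_empty {q x : RPSpace d} {m₀ : ℕ} {S : Finset (RPSpace d)} (hx : x ∈ S)
    (hS : S.card ≤ m₀) : missingSeeds q x m₀ S = ∅ := by
  ext ω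
  simp only [missingSeeds, Set.mem_ofPred_eq, Set.mem_empty_iff_false, iff_false, not_not]
  rw [rpTree, dif_neg (fun h => by omega), defeatistLeaf]
  exact hx

/-- The part of `S` on the left (`c = false`) or on the right (`c = true`) of the threshold. -/
noncomputable def splitPart (c : Bool) (S : Finset (RPSpace d))
    (p : Metric.sphere (0 : RPSpace d) 1 × ℝ) : Finset (RPSpace d) :=
  if c then rightPart (p.1 : RPSpace d) (fractile (p.1 : RPSpace d) p.2 S) S
  else leftPart (p.1 : RPSpace d) (fractile (p.1 : RPSpace d) p.2 S) S

theorem mem_splitPart {c : Bool} {S : Finset (RPSpace d)}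
    {p : Metric.sphere (0 : RPSpace d) 1 × ℝ} {v : RPSpace d} :
    v ∈ splitPart c S p ↔ v ∈ S ∧
      (inner ℝ (p.1 : RPSpace d) v ≤ fractile (p.1 : RPSpace d) p.2 S ↔ c = false) := by
  cases c <;> simp [splitPart, leftPart, rightPart]

theorem splitPart_subset (c : Bool) (S : Finset (RPSpace d))
    (p : Metric.sphere (0 : RPSpace d) 1 × ℝ) : splitPart c S p ⊆ S :=
  fun _ hv => (mem_splitPart.1 hv).1

theorem measurableSet_splitPart_eq {S : Finset (RPSpace d)} (hS : S.Nonempty) (c : Bool)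
    (T : Finset (RPSpace d)) : MeasurableSet {p | splitPart c S p = T} := by
  by_cases hT : T ⊆ S
  · have h : {p | splitPart c S p = T} = ⋂ v ∈ S, {p : Metric.sphere (0 : RPSpace d) 1 × ℝ |
        (inner ℝ (p.1 : RPSpace d) v ≤ fractile (p.1 : RPSpace d) p.2 S ↔ c = false) ↔ v ∈ T} := by
      ext p
      simp only [Finset.ext_iff, mem_splitPart, Set.mem_ofPred_eq, Set.mem_iInter]
      constructor
      · intro h v hv
        rw [← h v]; simp [hv]
      · intro h v
        constructor
        · exact fun hv => (h v hv.1).1 hv.2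
        · exact fun hv => ⟨hT hv, (h v (hT hv)).2 hv⟩
    rw [h]
    refine Finset.measurableSet_biInter _ fun v _ => ?_
    have hm := measurableSet_inner_le_fractile hS v
    cases c <;> by_cases hv : v ∈ T <;> simp only [hv, iff_true, iff_false, reduceCtorEq, not_not]
    exacts [hm, hm.compl, hm.compl, hm]
  · have h : {p | splitPart c S p = T} = ∅ := by
      ext p
      simp only [Set.mem_ofPred_eq, Set.mem_empty_iff_false, iff_false]
      rintro rfl
      exact hT (splitPart_subset c S p)
    rw [h]
    exact MeasurableSet.empty

theorem card_splitPart_le {S : Finset (RPSpace d)} (hs : 4 ≤ S.card)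
    {p : Metric.sphere (0 : RPSpace d) 1 × ℝ} (hb : p.2 ∈ Set.Icc (1 / 4 : ℝ) (3 / 4))
    (hinj : ∀ y ∈ S, ∀ z ∈ S,
      inner ℝ (p.1 : RPSpace d) y = inner ℝ (p.1 : RPSpace d) z → y = z) (c : Bool) :
    4 * (splitPart c S p).card ≤ 3 * S.card + 3 := by
  cases c
  · simpa [splitPart] using card_leftPart_le hb hs hinj
  · simpa [splitPart] using card_rightPart_le hb hs

/-- If `x` is missed, then it is separated from `q` at the root, or it is missed in the subtree to
which `q` is routed. -/
theorem missingSeeds_subset {q x : RPSpace d} {m₀ : ℕ} {S : Finset (RPSpace d)} (hxS : x ∈ S)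
    {ω : TreeSeed d} (hω : ω ∈ missingSeeds q x m₀ S)
    (hsep : ω [] ∉ separatingChoices q x S) :
    ∃ c : Bool, x ∈ splitPart c S (ω []) ∧ (splitPart c S (ω [])).card < S.card ∧
      (fun a => ω (c :: a)) ∈ missingSeeds q x m₀ (splitPart c S (ω [])) := by
  simp only [separatingChoices, Set.mem_ofPred_eq, not_not] at hsep
  simp only [missingSeeds, Set.mem_ofPred_eq] at hω
  rw [rpTree] at hω
  split_ifs at hω with h
  · rw [defeatistLeaf] at hω
    split_ifs at hω with hq
    · exact ⟨false, mem_splitPart.2 ⟨hxS, by simpa using hsep.1 hq⟩, h.2.1, hω⟩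
    · exact ⟨true, mem_splitPart.2 ⟨hxS, by simpa using hsep.not.1 hq⟩, h.2.2, hω⟩
  · exact absurd hxS hω

theorem treeLaw_missingSeeds_le [NeZero d] {q x : RPSpace d} {m₀ : ℕ}
    {S : Finset (RPSpace d)}
    (hx : IsNearestNeighbor q S x) (hs : 4 ≤ S.card) {B : ENNReal}
    (hB : ∀ T ⊆ S, x ∈ T → T.card < S.card → 4 * T.card ≤ 3 * S.card + 3 →
      treeLaw d (missingSeeds q x m₀ T) ≤ B) :
    treeLaw d (missingSeeds q x m₀ S) ≤ ENNReal.ofReal (potential q S S.card) + B := by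
  classical
  have hS : S.Nonempty := ⟨x, hx.1⟩
  have hev := measurePreserving_eval_infinitePi (fun _ : List Bool => nodeLaw d) []
  set I : Finset (Bool × Finset (RPSpace d)) := (Finset.univ ×ˢ S.powerset).filter
    fun cT => x ∈ cT.2 ∧ cT.2.card < S.card ∧ 4 * cT.2.card ≤ 3 * S.card + 3 with hI
  let A : Bool × Finset (RPSpace d) → Set (Metric.sphere (0 : RPSpace d) 1 × ℝ) :=
    fun cT => {p | splitPart cT.1 S p = cT.2}
  have hAm : ∀ cT, MeasurableSet (A cT) := fun cT => measurableSet_splitPart_eq hS _ _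
  have hdisj : Set.PairwiseDisjoint (I : Set (Bool × Finset (RPSpace d))) A := by
    rintro ⟨c, T⟩ h1 ⟨c', T'⟩ h2 hne
    rw [Function.onFun, Set.disjoint_left]
    intro p hp hp'
    simp only [A, Set.mem_ofPred_eq] at hp hp'
    simp only [hI, Finset.coe_filter, Set.mem_ofPred_eq] at h1 h2
    have hx1 := hp ▸ h1.2.1
    have hx2 := hp' ▸ h2.2.1
    rw [mem_splitPart] at hx1 hx2
    have hc : c = c' := by
      have := hx1.2.symm.trans hx2.2
      cases c <;> cases c' <;> simp_all
    subst hc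
    exact hne (by rw [← hp, ← hp'])
  have hcover : missingSeeds q x m₀ S ⊆
      ({ω | ¬ ((∀ y ∈ S, ∀ z ∈ S,
        inner ℝ ((ω []).1 : RPSpace d) y = inner ℝ ((ω []).1 : RPSpace d) z → y = z) ∧
          (ω []).2 ∈ Set.Icc (1 / 4 : ℝ) (3 / 4))} ∪ {ω | ω [] ∈ separatingChoices q x S}) ∪
      ⋃ cT ∈ I, {ω | ω [] ∈ A cT ∧ (fun a => ω (cT.1 :: a)) ∈ missingSeeds q x m₀ cT.2} := by
    intro ω hω
    by_cases hreg : (∀ y ∈ S, ∀ z ∈ S,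
        inner ℝ ((ω []).1 : RPSpace d) y = inner ℝ ((ω []).1 : RPSpace d) z → y = z) ∧
          (ω []).2 ∈ Set.Icc (1 / 4 : ℝ) (3 / 4)
    · by_cases hsep : ω [] ∈ separatingChoices q x S
      · exact Or.inl (Or.inr hsep)
      · obtain ⟨c, hxc, hcard, hc⟩ := missingSeeds_subset hx.1 hω hsep
        refine Or.inr (Set.mem_biUnion (x := (c, splitPart c S (ω []))) ?_ ⟨rfl, hc⟩)
        simp only [hI, Finset.coe_filter, Set.mem_ofPred_eq, Finset.mem_product, Finset.mem_univ,
          Finset.mem_powerset, true_and]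
        exact ⟨splitPart_subset _ _ _, hxc, hcard, card_splitPart_le hs hreg.2 hreg.1 c⟩
    · exact Or.inl (Or.inl hreg)
  have hnull : treeLaw d {ω | ¬ ((∀ y ∈ S, ∀ z ∈ S,
        inner ℝ ((ω []).1 : RPSpace d) y = inner ℝ ((ω []).1 : RPSpace d) z → y = z) ∧
          (ω []).2 ∈ Set.Icc (1 / 4 : ℝ) (3 / 4))} = 0 :=
    hev.quasiMeasurePreserving.ae (nodeLaw_ae_regular S)
  have hsep : treeLaw d {ω | ω [] ∈ separatingChoices q x S} ≤
      ENNReal.ofReal (potential q S S.card) :=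
    (hev.measure_preimage
      (measurableSet_separatingChoices hS q x).nullMeasurableSet).trans_le
        (nodeLaw_separatingChoices_le hs hx)
  refine (measure_mono hcover).trans ((measure_union_le _ _).trans (add_le_add ?_ ?_))
  · refine (measure_union_le _ _).trans ?_
    rw [hnull, zero_add]
    exact hsep
  · refine (measure_biUnion_finset_le _ _).trans ?_
    calc ∑ cT ∈ I, treeLaw d
          {ω | ω [] ∈ A cT ∧ (fun a => ω (cT.1 :: a)) ∈ missingSeeds q x m₀ cT.2}
        ≤ ∑ cT ∈ I, nodeLaw d (A cT) * B := by
          refine Finset.sum_le_sum fun cT hcT => ?_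
          rw [hI, Finset.mem_filter, Finset.mem_product, Finset.mem_powerset] at hcT
          exact (treeLaw_root_inter_subtree_le cT.1 (hAm cT) _).trans
            (mul_le_mul_right (hB cT.2 hcT.1.2 hcT.2.1 hcT.2.2.1 hcT.2.2.2) _)
      _ = nodeLaw d (⋃ cT ∈ I, A cT) * B := by
          rw [← Finset.sum_mul, measure_biUnion_finset hdisj fun cT _ => hAm cT]
      _ ≤ B := mul_le_of_le_one_left zero_le prob_le_one

theorem treeLaw_real_missingSeeds_le [NeZero d] {q x : RPSpace d} {m₀ : ℕ}
    {S : Finset (RPSpace d)} (hx : IsNearestNeighbor q S x) (hs : 4 ≤ S.card) {B : ℝ} (hB0 : 0 ≤ B)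
    (hB : ∀ T ⊆ S, x ∈ T → T.card < S.card → 4 * T.card ≤ 3 * S.card + 3 →
      (treeLaw d).real (missingSeeds q x m₀ T) ≤ B) :
    (treeLaw d).real (missingSeeds q x m₀ S) ≤ potential q S S.card + B := by
  have : IsProbabilityMeasure (treeLaw d) := by unfold treeLaw; infer_instance
  have h0 := potential_nonneg q S S.card
  rw [measureReal_def, ← ENNReal.le_ofReal_iff_toReal_le (measure_ne_top _ _) (by positivity),
    ENNReal.ofReal_add h0 hB0]
  exact treeLaw_missingSeeds_le hx hs fun T h1 h2 h3 h4 =>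
    (ENNReal.le_ofReal_iff_toReal_le (measure_ne_top _ _) hB0).2 (hB T h1 h2 h3 h4)

theorem missingSeeds_self {x : RPSpace d} {m₀ : ℕ} {S : Finset (RPSpace d)} (hx : x ∈ S) :
    missingSeeds x x m₀ S = ∅ := by
  induction hn : S.card using Nat.strong_induction_on generalizing S with
  | _ n ih =>
    ext ω
    simp only [Set.mem_empty_iff_false, iff_false]
    intro hω
    obtain ⟨c, hxc, hcard, hc⟩ := missingSeeds_subset hx hω (by simp [separatingChoices])
    rw [ih _ (hn ▸ hcard) hxc rfl] at hc
    exact hc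

end Recursion

/-! ### Summation over the levels of the tree -/

theorem Real.exp_five_thirds_le : Real.exp (5 / 3) ≤ 16 / 3 := by
  have h1 : Real.exp (5 / 3) ^ 3 = Real.exp 1 ^ 5 := by
    rw [← Real.exp_nat_mul, ← Real.exp_nat_mul]; norm_num
  have h2 : Real.exp 1 ^ 5 ≤ 2.7182818286 ^ 5 :=
    pow_le_pow_left₀ (Real.exp_pos _).le Real.exp_one_lt_d9.le 5
  refine le_of_pow_le_pow_left₀ three_ne_zero (by norm_num) (h1.trans_le (h2.trans ?_))
  norm_num

/-- A linear lower bound for `t ln (2e / t)`, valid as long as its value is at most `1`. -/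
theorem min_le_mul_log {t : ℝ} (h0 : 0 ≤ t) (h1 : t ≤ 1) :
    min 1 (8 / 3 * t) ≤ t * Real.log (2 * Real.exp 1 / t) := by
  rcases h0.eq_or_lt with rfl | h0
  · simp
  have he : 0 < Real.exp (5 / 3) := Real.exp_pos _
  set y := t * Real.exp (5 / 3) / 2 with hy
  have hy0 : 0 < y := by positivity
  have hlog : Real.log (2 * Real.exp 1 / t) = 8 / 3 - Real.log y := by
    have hty : 2 * Real.exp 1 / t = Real.exp (8 / 3) / y := by
      rw [hy, show (8 / 3 : ℝ) = 1 + 5 / 3 by norm_num, Real.exp_add]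
      field_simp
    rw [hty, Real.log_div (Real.exp_pos _).ne' hy0.ne', Real.log_exp]
  rw [hlog]
  rcases le_total y 1 with hy1 | hy1
  · refine (min_le_right _ _).trans ?_
    nlinarith [Real.log_nonpos hy0.le hy1]
  · refine (min_le_left _ _).trans ?_
    have hle := Real.log_le_sub_one_of_pos hy0
    have hy2 : y ≤ 8 / 3 := by
      rw [hy]; nlinarith [Real.exp_five_thirds_le]
    have h3 : 8 / 3 ≤ y * (8 / 3 - Real.log y) := by nlinarith
    have h4 : y ≤ t * (8 / 3) := by
      rw [hy]; nlinarith [Real.exp_five_thirds_le]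
    have h5 : t * Real.exp (5 / 3) = 2 * y := by rw [hy]; ring
    have hpos : 0 < 8 / 3 - Real.log y := by nlinarith
    have h6 : 3 / 8 * y ≤ t := by linarith
    nlinarith

section Levels

variable {d : ℕ} {q x : RPSpace d} {X : Finset (RPSpace d)} {m₀ : ℕ}

theorem potential_le_floor (q : RPSpace d) (X : Finset (RPSpace d)) {n : ℕ} (hn : 0 < n) {T : ℝ}
    (h1 : n ≤ T) (h2 : 3 / 4 * T ≤ n) : potential q X n ≤ 4 / 3 * potential q X ⌊T⌋₊ := by
  have hn' : (0 : ℝ) < n := by exact_mod_cast hn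
  have h := natCast_mul_potential_mono q X (Nat.le_floor h1)
  have hfl := Nat.floor_le (hn'.le.trans h1)
  have h0 := potential_nonneg q X ⌊T⌋₊
  refine le_of_mul_le_mul_left (h.trans ?_) hn'
  nlinarith

theorem treeLaw_real_missingSeeds_le_sum [NeZero d] (hx : IsNearestNeighbor q X x) (hm₀ : 3 ≤ m₀)
    {L : ℕ} (hL : (3 / 4 : ℝ) ^ L * X.card < m₀) {S : Finset (RPSpace d)} (hSX : S ⊆ X)
    (hxS : x ∈ S) {l : ℕ} (hl : l ≤ L) (hS : (S.card : ℝ) ≤ (3 / 4) ^ l * X.card) :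
    ((treeLaw d).real (missingSeeds q x m₀ S) ≤
      2 * ∑ i ∈ Finset.Ico l L, 4 / 3 * potential q X ⌊(3 / 4 : ℝ) ^ i * X.card⌋₊) ∧
    ((((3 * S.card + 3) / 4 : ℕ) : ℝ) ≤ (3 / 4) ^ (l + 1) * X.card → l < L →
      (treeLaw d).real (missingSeeds q x m₀ S) ≤
        4 / 3 * potential q X ⌊(3 / 4 : ℝ) ^ l * X.card⌋₊ +
        2 * ∑ i ∈ Finset.Ico (l + 1) L, 4 / 3 * potential q X ⌊(3 / 4 : ℝ) ^ i * X.card⌋₊) := by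
  have hc : ∀ i, 0 ≤ 4 / 3 * potential q X ⌊(3 / 4 : ℝ) ^ i * X.card⌋₊ := fun i =>
    mul_nonneg (by norm_num) (potential_nonneg _ _ _)
  generalize hcdef : (fun i : ℕ => 4 / 3 * potential q X ⌊(3 / 4 : ℝ) ^ i * X.card⌋₊) = c at *
  have hc' : ∀ i, 4 / 3 * potential q X ⌊(3 / 4 : ℝ) ^ i * X.card⌋₊ = c i := fun i => by
    rw [← hcdef]
  simp only [hc'] at hc ⊢
  have hsum : ∀ l, 0 ≤ 2 * ∑ i ∈ Finset.Ico l L, c i := fun l =>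
    mul_nonneg zero_le_two (Finset.sum_nonneg fun i _ => hc i)
  induction hn : S.card using Nat.strong_induction_on generalizing S l with
  | _ n ih =>
    rcases le_or_gt S.card m₀ with hcard | hcard
    · rw [missingSeeds_eq_empty hxS hcard, measureReal_empty]
      exact ⟨hsum l, fun _ _ => add_nonneg (hc l) (hsum _)⟩
    subst hn
    obtain ⟨k, hk⟩ := Nat.exists_eq_add_of_le hl
    induction k generalizing l with
    | zero =>
      have h1 : (m₀ : ℝ) < S.card := by exact_mod_cast hcard
      rw [add_zero] at hk
      rw [← hk] at hS
      linarith
    | succ k ihk =>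
      have hlL : l < L := by omega
      have hsplit : ∑ i ∈ Finset.Ico l L, c i = c l + ∑ i ∈ Finset.Ico (l + 1) L, c i :=
        Finset.sum_eq_sum_Ico_succ_bot hlL _
      rcases le_or_gt (S.card : ℝ) ((3 / 4) ^ (l + 1) * X.card) with hle | hgt
      · have h := (ihk (l := l + 1) hlL hle (by omega)).1
        have hcl := hc l
        refine ⟨?_, fun _ _ => by linarith⟩
        rw [hsplit]; linarith
      · have hpot : potential q S S.card ≤ c l := by
          refine (potential_le_of_subset hx hSX hxS).trans ?_
          rw [← hc']
          refine potential_le_floor q X (by omega) hS ?_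
          rw [pow_succ] at hgt
          linarith
        have hxS' := hx.mono hSX hxS
        constructor
        · have h := treeLaw_real_missingSeeds_le (m₀ := m₀) hxS' (by omega)
            (add_nonneg (hc l) (hsum (l + 1))) fun T hTS hxT hT1 hT2 => ?_
          · rw [hsplit]; linarith
          · refine (ih T.card hT1 (hTS.trans hSX) hxT hl ?_ rfl).2 ?_ hlL
            · exact le_trans (by exact_mod_cast hT1.le) hS
            · have h1 : 4 * ((3 * T.card + 3) / 4) ≤ 3 * S.card := by
                generalize T.card = a at hT1 hT2 ⊢
                generalize S.card = b at hT1 hT2 hcard ⊢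
                rcases lt_or_ge b 7 with hb | hb
                · interval_cases b <;> omega
                · omega
              have h2 : (4 : ℝ) * (((3 * T.card + 3) / 4 : ℕ) : ℝ) ≤ 3 * S.card := by
                exact_mod_cast h1
              rw [pow_succ]
              linarith
        · intro hnext _
          have h := treeLaw_real_missingSeeds_le (m₀ := m₀) hxS' (by omega)
            (hsum (l + 1)) fun T hTS hxT hT1 hT2 => ?_
          · linarith
          · refine (ih T.card hT1 (hTS.trans hSX) hxT hlL ?_ rfl).1
            refine le_trans ?_ hnext
            have : T.card ≤ (3 * S.card + 3) / 4 := by omega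
            exact_mod_cast this

theorem pow_floor_logb_succ_mul_lt {m m₀ : ℕ} (hm : 0 < m) (hm₀ : 0 < m₀) :
    (3 / 4 : ℝ) ^ (⌊Real.logb (4 / 3) ((m : ℝ) / m₀)⌋₊ + 1) * m < m₀ := by
  have hm' : (0 : ℝ) < m := by exact_mod_cast hm
  have hm₀' : (0 : ℝ) < m₀ := by exact_mod_cast hm₀
  have h := Nat.lt_floor_add_one (Real.logb (4 / 3) ((m : ℝ) / m₀))
  rw [Real.logb_lt_iff_lt_rpow (by norm_num) (by positivity)] at h
  norm_cast at h
  rw [div_lt_iff₀ hm₀'] at h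
  have hp : (0 : ℝ) < (3 / 4) ^ (⌊Real.logb (4 / 3) ((m : ℝ) / m₀)⌋₊ + 1) := by positivity
  have h2 := mul_lt_mul_of_pos_left h hp
  rwa [← mul_assoc, ← mul_pow, show (3 / 4 : ℝ) * (4 / 3) = 1 by norm_num, one_pow,
    one_mul] at h2

theorem le_pow_floor_logb_mul {m m₀ : ℕ} (hm₀ : 0 < m₀) (hm : m₀ ≤ m) :
    (m₀ : ℝ) ≤ (3 / 4 : ℝ) ^ ⌊Real.logb (4 / 3) ((m : ℝ) / m₀)⌋₊ * m := by
  have hm₀' : (0 : ℝ) < m₀ := by exact_mod_cast hm₀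
  have hm1 : (1 : ℝ) ≤ (m : ℝ) / m₀ := (one_le_div hm₀').2 (by exact_mod_cast hm)
  have h := Nat.floor_le (Real.logb_nonneg (by norm_num : (1 : ℝ) < 4 / 3) hm1)
  rw [Real.le_logb_iff_rpow_le (by norm_num) (by positivity), Real.rpow_natCast,
    le_div_iff₀ hm₀'] at h
  have hp : (0 : ℝ) < (3 / 4) ^ ⌊Real.logb (4 / 3) ((m : ℝ) / m₀)⌋₊ := by positivity
  have h2 := mul_le_mul_of_nonneg_left h hp.le
  rwa [← mul_assoc, ← mul_pow, show (3 / 4 : ℝ) * (4 / 3) = 1 by norm_num, one_pow,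
    one_mul] at h2

theorem treeLaw_real_missingSeeds_le_sum_log [NeZero d] (hx : IsNearestNeighbor q X x)
    (hm₀ : 1 ≤ m₀) :
    (treeLaw d).real (missingSeeds q x m₀ X) ≤
      ∑ l ∈ Finset.range (⌊Real.logb (4 / 3) ((X.card : ℝ) / m₀)⌋₊ + 1),
        potential q X ⌊(3 / 4 : ℝ) ^ l * X.card⌋₊ *
          Real.log (2 * Real.exp 1 / potential q X ⌊(3 / 4 : ℝ) ^ l * X.card⌋₊) := by
  have : IsProbabilityMeasure (treeLaw d) := by unfold treeLaw; infer_instance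
  set φ : ℕ → ℝ := fun l => potential q X ⌊(3 / 4 : ℝ) ^ l * X.card⌋₊ with hφ
  set ℓ := ⌊Real.logb (4 / 3) ((X.card : ℝ) / m₀)⌋₊ with hℓ
  have hmin : ∀ l, min 1 (8 / 3 * φ l) ≤ φ l * Real.log (2 * Real.exp 1 / φ l) := fun l =>
    min_le_mul_log (potential_nonneg _ _ _) (potential_le_one hx _)
  have hnonneg : ∀ l, 0 ≤ φ l * Real.log (2 * Real.exp 1 / φ l) := fun l =>
    (le_min zero_le_one (mul_nonneg (by norm_num) (potential_nonneg _ _ _))).trans (hmin l)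
  have hsum := Finset.sum_nonneg fun l (_ : l ∈ Finset.range (ℓ + 1)) => hnonneg l
  rcases le_or_gt X.card m₀ with hcard | hcard
  · rwa [missingSeeds_eq_empty hx.1 hcard, measureReal_empty]
  rcases eq_or_ne q x with rfl | hqx
  · rwa [missingSeeds_self hx.1, measureReal_empty]
  by_cases hbig : ∃ l ∈ Finset.range (ℓ + 1), 1 ≤ φ l * Real.log (2 * Real.exp 1 / φ l)
  · obtain ⟨l, hl, h1⟩ := hbig
    exact measureReal_le_one.trans
      (h1.trans (Finset.single_le_sum (fun l _ => hnonneg l) hl))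
  push Not at hbig
  have hlin : ∀ l ∈ Finset.range (ℓ + 1),
      8 / 3 * φ l ≤ φ l * Real.log (2 * Real.exp 1 / φ l) := fun l hl => by
    rcases min_le_iff.1 (hmin l) with h | h
    · exact absurd (hbig l hl) h.not_gt
    · exact h
  have hL := pow_floor_logb_succ_mul_lt (card_pos_of_isNearestNeighbor hx) hm₀
  rw [← hℓ] at hL
  rcases le_or_gt 3 m₀ with h3 | h3
  · have h := (treeLaw_real_missingSeeds_le_sum hx h3 hL Finset.Subset.rfl hx.1 (Nat.zero_le _)
      (by simp)).1
    refine h.trans ((le_of_eq ?_).trans (Finset.sum_le_sum hlin))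
    rw [Finset.mul_sum, Finset.range_eq_Ico]
    exact Finset.sum_congr rfl fun l _ => by rw [hφ]; ring
  · exfalso
    have hmem : ℓ ∈ Finset.range (ℓ + 1) := Finset.self_mem_range_succ ℓ
    have hT := le_pow_floor_logb_mul hm₀ hcard.le
    rw [← hℓ] at hT
    have hm₀' : (1 : ℝ) ≤ m₀ := by exact_mod_cast hm₀
    have h3' : (m₀ : ℝ) ≤ 2 := by exact_mod_cast (by omega : m₀ ≤ 2)
    have hN1 : 1 ≤ ⌊(3 / 4 : ℝ) ^ ℓ * X.card⌋₊ := Nat.le_floor (by push_cast; linarith)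
    have hN2 : ⌊(3 / 4 : ℝ) ^ ℓ * X.card⌋₊ < 3 := by
      rw [Nat.floor_lt (by positivity)]
      rw [pow_succ] at hL
      push_cast
      linarith
    have hpot := one_div_le_potential hx hqx hN1
    have hhalf : (1 : ℝ) / 2 ≤ 1 / (⌊(3 / 4 : ℝ) ^ ℓ * X.card⌋₊ : ℝ) :=
      one_div_le_one_div_of_le (by exact_mod_cast hN1) (by exact_mod_cast (by omega))
    have h1 := hlin ℓ hmem
    have h2 := hbig ℓ hmem
    have h4 : 1 / 2 ≤ φ ℓ := hhalf.trans hpot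
    linarith

end Levels

theorem mainTheorem7 (d : ℕ) [NeZero d] :
    -- the two-point formula
    (∀ q x y : RPSpace d, q ≠ x → x ≠ y → ‖q - x‖ ≤ ‖q - y‖ →
      (sphereUniform d).real {u | ProjBetween (u : RPSpace d) q x y} =
        1 / Real.pi * Real.arcsin (2 * reducedPotential q (pairCollection x y) 2 *
          √(1 - (inner ℝ (q - x) (y - x) / (‖q - x‖ * ‖y - x‖)) ^ 2))) ∧
    -- the expected fraction of points between the query and its nearest neighbour
    (∀ (q : RPSpace d) (X : Finset (RPSpace d)) (x : RPSpace d), IsNearestNeighbor q X x →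
      Integrable (fun u : Metric.sphere (0 : RPSpace d) 1 => fractionBetween q X x (u : RPSpace d))
        (sphereUniform d) ∧
      ∫ u, fractionBetween q X x (u : RPSpace d) ∂(sphereUniform d) ≤
        1 / 2 * reducedPotential q X X.card) ∧
    -- the failure probability of defeatist search
    (∀ (q : RPSpace d) (X : Finset (RPSpace d)) (x : RPSpace d) (m₀ : ℕ), 1 ≤ m₀ →
      IsNearestNeighbor q X x →
      (treeLaw d).real {ω | ¬ DefeatistFinds q (rpTree m₀ X ω) x} ≤
        ∑ l ∈ Finset.range (⌊Real.logb (4 / 3) ((X.card : ℝ) / m₀)⌋₊ + 1),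
          potential q X ⌊(3 / 4 : ℝ) ^ l * X.card⌋₊ *
            Real.log (2 * Real.exp 1 / potential q X ⌊(3 / 4 : ℝ) ^ l * X.card⌋₊)) := by
  refine ⟨fun q x y hqx hxy h => ?_, fun q X x hx =>
    ⟨integrable_fractionBetween q X x, integral_fractionBetween_le hx⟩,
    fun q X x m₀ hm₀ hx => ?_⟩
  · rw [two_mul_reducedPotential_pair hxy h]
    exact sphereUniform_real_projBetween_eq_arcsin hqx hxy h
  · have : IsProbabilityMeasure (treeLaw d) := by unfold treeLaw; infer_instance
    refine le_trans (measureReal_mono ?_) (treeLaw_real_missingSeeds_le_sum_log hx hm₀)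
    exact fun ω hω hmem => hω (defeatistFinds_of_mem hx hmem)
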